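/- Let $n\ge 1$. A simple polytope $P\subset\mathbb R^n$ is the convex hull of finitely many points, of dimension $n$, such that every vertex lies on exactly $n$ facets; $V(P)$ and $\mathcal F(P)$ denote its sets of vertices and facets. An $\mathcal R$-characteristic pair $(P,\lambda)$ consists of such a $P$ and a map $\lambda:\mathcal F(P)\to\mathbb Z^n$ with primitive values such that the vectors of any distinct facets with nonempty common intersection are linearly independent; it is a characteristic pair if moreover such vectors always span a direct summand of $\mathbb Z^n$. Let $T^n$ be the compact torus $(S^1)^n$. The toric orbifold of $(P,\lambda)$ is $M(P,\lambda)=(T^n\times P)/\!\sim$, where $(t,x)\sim(s,y)$ iff $x=y$ and $t^{-1}s$ lies in the subgroup generated by the circles $\exp(\mathbb R\lambda(F_i))$ over the facets $F_i\ni x$; $T^n$ acts on the first factor and $\pi:M(P,\lambda)\to P$ is the projection. $M(P,\lambda)$ is a toric manifold if $(P,\lambda)$ is a characteristic pair and $M(P,\lambda)$ is a closed smooth $2n$-manifold covered by $T^n$-invariant smooth charts to $\mathbb C^n$ in which the action is the standard one up to an automorphism of $T^n$, with $\pi$ as the quotient map by the $T^n$-action. For a face $F$ of $P$, with $F_{i_1},\dots,F_{i_k}$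 the facets containing $F$, put $$G_F(P,\lambda)=\frac{(\langle\lambda(F_{i_1}),\dots,\lambda(F_{i_k})\rangle\otimes\mathbb R)\cap\mathbb Z^n}{\langle\lambda(F_{i_1}),\dots,\lambda(F_{i_k})\rangle}.$$ If $H$ is a hyperplane with $V(F)\subset H_{>0}$ and $V(P)\setminus V(F)\subset H_{<0}$, then $\overline P=P\cap H_{\le 0}$ is a blowup of $P$ along $F$; if $(\overline P,\overline\lambda)$ is an $\mathcal R$-characteristic pair with $\overline\lambda(F_i\cap\overline P)=\lambda(F_i)$ whenever $F_i\in\mathcal F(P)$ and $F_i\cap\overline P$ is a facet of $\overline P$, then $M(\overline P,\overline\lambda)$ is called a blowup of $M(P,\lambda)$ along $\pi^{-1}(F)$. **Theorem.** For every $\mathcal R$-characteristic pair $(P,\lambda)$ there are $d\ge 0$ and a finite sequence of blowups $$M(P^{(d)},\lambda^{(d)})\to\dots\to M(P^{(1)},\lambda^{(1)})\to M(P^{(0)},\lambda^{(0)})=M(P,\lambda)$$ such that $M(P^{(d)},\lambda^{(d)})$ is a toric manifold and, for each $i=1,\dots,d$, $M(P^{(i)},\lambda^{(i)})$ is a blowup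 of $M(P^{(i-1)},\lambda^{(i-1)})$ along $\pi^{-1}(F)$ for a face $F$ of $P^{(i-1)}$ which is maximal among the faces with $|G_F(P^{(i-1)},\lambda^{(i-1)})|\ne1$, with the following properties. Let $H$ be the hyperplane used and $F_{i_1},\dots,F_{i_k}$ the facets of $P^{(i-1)}$ containing $F$. 1. $E=P^{(i-1)}\cap H$ is a facet of $P^{(i)}$, and $\lambda^{(i)}(E)$ is the primitive vector of a nonzero lattice point $\sum_{j=1}^k c_j\lambda^{(i-1)}(F_{i_j})\in\mathbb Z^n$ with $c_j\in\mathbb Q$ and $0<|c_j|<1$ for all $j$. 2. The vertices of $P^{(i)}$ not in $E$ are exactly the vertices of $P^{(i-1)}$ not in $F$, and the order of the group $G$ at these is the same for both pairs. 3. Every vertex $w$ of $P^{(i)}$ in $E$ lies over exactly one vertex $b$ of $F$, in the sense that every facet of $P^{(i-1)}$ through $w$ passes through $b$; over every vertex $b$ of $F$ lie exactly $k$ such vertices $w$; and $|G_w(P^{(i)},\lambda^{(i)})|<|G_b(P^{(i-1)},\lambda^{(i-1)})|$ for each of them. -/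

import Mathlib

noncomputable section

open scoped Manifold ContDiff

namespace ToricOrb

/-! ### Polytopes -/

/-- The nonempty faces of a convex polytope `P` (including `P` itself): the sets of maximizers on
`P` of linear functionals. -/
def IsFace {n : ℕ} (P F : Set (Fin n → ℝ)) : Prop :=
  IsExposed ℝ P F ∧ F.Nonempty

/-- Facets: faces of dimension `n - 1`. -/
def IsFacet {n : ℕ} (P F : Set (Fin n → ℝ)) : Prop :=
  IsFace P F ∧ Module.finrank ℝ (vectorSpan ℝ F) + 1 = n

/-- `V(P)`: the zero-dimensional faces. -/
def vertices {n : ℕ} (P : Set (Fin n → ℝ)) : Set (Fin n → ℝ) :=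
  {v | IsFace P {v}}

/-- `n`-dimensional simple polytopes in `ℝⁿ`: convex hulls of finitely many points, with nonempty
interior, such that every vertex lies on exactly `n` facets. -/
structure IsSimplePolytope {n : ℕ} (P : Set (Fin n → ℝ)) : Prop where
  exists_convexHull : ∃ s : Finset (Fin n → ℝ), P = convexHull ℝ (s : Set (Fin n → ℝ))
  interior_nonempty : (interior P).Nonempty
  ncard_facets : ∀ v ∈ vertices P, {F | IsFacet P F ∧ v ∈ F}.ncard = n

/-! ### Characteristic pairs -/

/-- Primitive vectors of `ℤⁿ`: the coordinates have no common divisor except `±1`. -/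
def IsPrimitiveVec {n : ℕ} (v : Fin n → ℤ) : Prop :=
  ∀ k : ℤ, (∀ i, k ∣ v i) → IsUnit k

/-- An `R`-characteristic pair `(P, lam)` in dimension `n`. -/
structure RCharPair (n : ℕ) where
  /-- the simple polytope `P` -/
  poly : Set (Fin n → ℝ)
  isSimple : IsSimplePolytope poly
  /-- the `R`-characteristic function on the set of facets of `P` -/
  lam : {F : Set (Fin n → ℝ) // IsFacet poly F} → (Fin n → ℤ)
  primitive : ∀ F, IsPrimitiveVec (lam F)
  indep : ∀ S : Set {F : Set (Fin n → ℝ) // IsFacet poly F},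
    (⋂ F ∈ S, F.1).Nonempty → LinearIndependent ℤ (fun F : S => lam F.1)

namespace RCharPair

variable {n : ℕ}

/-- The set of facets of the polytope. -/
abbrev Facet (A : RCharPair n) : Type := {F : Set (Fin n → ℝ) // IsFacet A.poly F}

/-- `(P, lam)` is a characteristic pair: facets with a common point have (linearly independent)
vectors which span a direct summand of `ℤⁿ`. -/
def IsCharacteristic (A : RCharPair n) : Prop :=
  ∀ S : Set A.Facet, (⋂ F ∈ S, F.1).Nonempty →
    ∃ N : Submodule ℤ (Fin n → ℤ), IsCompl (Submodule.span ℤ (A.lam '' S)) N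

/-- The characteristic vectors of the facets containing `F`. For a face `F` of codimension `k`
these are the vectors of the `k` facets whose intersection is `F`. -/
def vecs (A : RCharPair n) (F : Set (Fin n → ℝ)) : Set (Fin n → ℤ) :=
  A.lam '' {G | F ⊆ G.1}

end RCharPair

/-- The inclusion `ℤⁿ → ℝⁿ`. -/
def intCast (n : ℕ) : (Fin n → ℤ) →ₗ[ℤ] (Fin n → ℝ) :=
  (Int.castAddHom ℝ).toIntLinearMap.compLeft (Fin n)

/-- `(⟨S⟩ ⊗ ℝ) ∩ ℤⁿ`. -/
def saturation {n : ℕ} (S : Set (Fin n → ℤ)) : Submodule ℤ (Fin n → ℤ) :=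
  ((Submodule.span ℝ (intCast n '' S)).restrictScalars ℤ).comap (intCast n)

namespace RCharPair

variable {n : ℕ}

/-- The local group `G_F = ((⟨vecs F⟩ ⊗ ℝ) ∩ ℤⁿ) / ⟨vecs F⟩`. -/
abbrev localGroup (A : RCharPair n) (F : Set (Fin n → ℝ)) : Type :=
  saturation (A.vecs F) ⧸
    (Submodule.span ℤ (A.vecs F)).comap (saturation (A.vecs F)).subtype

/-- The order `|G_F|`. -/
def singOrder (A : RCharPair n) (F : Set (Fin n → ℝ)) : ℕ :=
  Nat.card (A.localGroup F)

/-! ### The space `M(P, lam)` -/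

/-- The circle subgroup of `Tⁿ` which is the image of the line `ℝ v` under the exponential map:
the elements `(z ^ v₁, …, z ^ vₙ)` with `z` in the unit circle. -/
def circleSubgroup (v : Fin n → ℤ) : Subgroup (Fin n → Circle) :=
  (MonoidHom.pi fun i => zpowGroupHom (α := Circle) (v i)).range

/-- `T_F`, the subgroup of `Tⁿ` generated by the circles of the facets containing `F`. -/
def faceTorus (A : RCharPair n) (F : Set (Fin n → ℝ)) : Subgroup (Fin n → Circle) :=
  ⨆ G : {G : A.Facet // F ⊆ G.1}, circleSubgroup (A.lam G.1)

/-- The relation `(t, x) ∼ (s, y)` iff `x = y` and `t⁻¹ s ∈ T_F`, where `F` is the face having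
`x` in its relative interior. A facet contains `F` iff it contains `x`, so `T_F = T_{x}`. -/
def toricSetoid (A : RCharPair n) : Setoid ((Fin n → Circle) × A.poly) where
  r p q := p.2 = q.2 ∧ p.1⁻¹ * q.1 ∈ A.faceTorus {p.2.1}
  iseqv :=
    { refl := fun p => ⟨rfl, by simp [one_mem]⟩
      symm := by
        rintro ⟨t, x⟩ ⟨s, y⟩ ⟨h, h'⟩
        dsimp only at h h'
        subst h
        refine ⟨rfl, ?_⟩
        simpa using inv_mem h'
      trans := by
        rintro ⟨t, x⟩ ⟨s, y⟩ ⟨u, z⟩ ⟨h, h'⟩ ⟨k, k'⟩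
        dsimp only at h h' k k'
        subst h
        subst k
        refine ⟨rfl, ?_⟩
        have := mul_mem h' k'
        simpa [mul_assoc] using this }

/-- The space `M(P, lam) = (Tⁿ × P) / ∼`. -/
def Space (A : RCharPair n) : Type := Quotient A.toricSetoid

/-- `M(P, lam)` carries the quotient topology. -/
instance (A : RCharPair n) : TopologicalSpace A.Space :=
  inferInstanceAs (TopologicalSpace (Quotient A.toricSetoid))

/-- The action of `Tⁿ` on `M(P, lam)` by multiplication on the first factor. -/
instance (A : RCharPair n) : MulAction (Fin n → Circle) A.Space where
  smul t := Quotient.map (sa := A.toricSetoid) (sb := A.toricSetoid)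
    (fun p => (t * p.1, p.2)) (by
      rintro p q ⟨h, h'⟩
      refine ⟨h, ?_⟩
      dsimp only
      rw [mul_inv_rev, mul_assoc, inv_mul_cancel_left]
      exact h')
  one_smul m := by
    induction m using Quotient.inductionOn with
    | h p => exact congrArg (Quotient.mk A.toricSetoid) (Prod.ext (one_mul _) rfl)
  mul_smul t s m := by
    induction m using Quotient.inductionOn with
    | h p => exact congrArg (Quotient.mk A.toricSetoid) (Prod.ext (mul_assoc _ _ _) rfl)

/-- The orbit map `π : M(P, lam) → P`. -/
def orbitMap (A : RCharPair n) : A.Space → A.poly :=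
  Quotient.lift (s := A.toricSetoid) (fun p => p.2) (fun _ _ h => h.1)

/-- `M(P, lam)` is a toric manifold: `lam` is a characteristic function, and `M(P, lam)`, with its
quotient topology and its `Tⁿ`-action, is a closed smooth `2n`-dimensional manifold covered by
`Tⁿ`-invariant smooth charts in which the action is, up to an automorphism of `Tⁿ`, the standard
action on `ℂⁿ`, with orbit space `P` via `π`. -/
structure IsToricManifold (A : RCharPair n) : Prop where
  characteristic : A.IsCharacteristic
  compactSpace : CompactSpace A.Space
  t2Space : T2Space A.Space
  secondCountable : SecondCountableTopology A.Space
  exists_smooth : ∃ _ : ChartedSpace (Fin n → ℂ) A.Space,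
    IsManifold 𝓘(ℝ, Fin n → ℂ) ∞ A.Space ∧
    ∀ e ∈ atlas (Fin n → ℂ) A.Space,
      (∀ (t : Fin n → Circle), ∀ m ∈ e.source, t • m ∈ e.source) ∧
      ∃ ψ : (Fin n → Circle) ≃ₜ* (Fin n → Circle),
        ∀ (t : Fin n → Circle), ∀ m ∈ e.source,
          e (t • m) = fun j => (ψ t j : ℂ) * e m j
  isQuotientMap : Topology.IsQuotientMap A.orbitMap
  orbitMap_eq_iff : ∀ m m' : A.Space,
    A.orbitMap m = A.orbitMap m' ↔ ∃ t : Fin n → Circle, t • m = m'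

/-! ### Blowups -/

/-- `M(B)` is the blowup of `M(A)` along `π⁻¹(F)`, the face `F` being cut off by the hyperplane
`{l = c}`. -/
structure IsBlowup (A B : RCharPair n) (F : Set (Fin n → ℝ))
    (l : (Fin n → ℝ) →L[ℝ] ℝ) (c : ℝ) : Prop where
  isFace : IsFace A.poly F
  ne_zero : l ≠ 0
  pos_of_mem : ∀ v ∈ vertices A.poly, v ∈ F → c < l v
  neg_of_notMem : ∀ v ∈ vertices A.poly, v ∉ F → l v < c
  poly_eq : B.poly = A.poly ∩ {x | l x ≤ c}
  lam_eq : ∀ (G : A.Facet) (G' : B.Facet), G'.1 = G.1 ∩ B.poly → B.lam G' = A.lam G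

/-- `F` is maximal, for inclusion, among the faces with nontrivial local group. -/
def IsMaximalSingular (A : RCharPair n) (F : Set (Fin n → ℝ)) : Prop :=
  Maximal (fun G => IsFace A.poly G ∧ A.singOrder G ≠ 1) F

/-- The vertices of `B` on its facet `E` that arise from the vertex `b` of `A`: all facets of `A`
through such a vertex also pass through `b`. -/
def verticesOver (A B : RCharPair n) (E : B.Facet) (b : Fin n → ℝ) : Set (Fin n → ℝ) :=
  {w | w ∈ vertices B.poly ∧ w ∈ E.1 ∧ ∀ G : A.Facet, w ∈ G.1 → b ∈ G.1}

/-- One step `M(B) → M(A)` of the resolution. -/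
def IsResolutionStep (A B : RCharPair n) : Prop :=
  ∃ (F : Set (Fin n → ℝ)) (l : (Fin n → ℝ) →L[ℝ] ℝ) (c : ℝ),
    -- `B` is a blowup of `A` along a maximal singular face `F`
    A.IsMaximalSingular F ∧ IsBlowup A B F l c ∧
    -- the section of the polytope by the hyperplane is a facet `E` of `B`
    ∃ E : B.Facet, E.1 = A.poly ∩ {x | l x = c} ∧
    -- the facets containing `F` are `i 0, …, i (k - 1)`
    ∃ (k : ℕ) (i : Fin k → A.Facet), Function.Injective i ∧ Set.range i = {G | F ⊆ G.1} ∧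
    -- the vector of `E` is the primitive vector of a lattice point `∑ⱼ qⱼ λ(iⱼ)`, `0 < |qⱼ| < 1`
    (∃ (q : Fin k → ℚ) (v : Fin n → ℤ) (m : ℕ),
      (∀ j, 0 < |q j| ∧ |q j| < 1) ∧ v ≠ 0 ∧
      (∀ a, (v a : ℚ) = ∑ j, q j * (A.lam (i j) a : ℚ)) ∧
      0 < m ∧ v = m • B.lam E) ∧
    -- the vertices off `F` stay, with the same order
    vertices B.poly \ E.1 = vertices A.poly \ F ∧
    (∀ v ∈ vertices A.poly \ F, B.singOrder {v} = A.singOrder {v}) ∧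
    -- every vertex of `F` is replaced by `k` vertices on `E`, of strictly smaller order
    (∀ w ∈ vertices B.poly ∩ E.1,
      ∃! b, b ∈ vertices A.poly ∩ F ∧ w ∈ verticesOver A B E b) ∧
    ∀ b ∈ vertices A.poly ∩ F, (verticesOver A B E b).ncard = k ∧
      ∀ w ∈ verticesOver A B E b, B.singOrder {w} < A.singOrder {b}

end RCharPair

end ToricOrb

end

/-! Let `F` be a maximal singular face and `λ₁, …, λₖ` the vectors of the facets containing it. Take
a lattice point in the saturation of these vectors but outside their integer span, and drop the
integer parts of its rational coefficients. All the remaining coefficients `qⱼ` lie in `(0, 1)`: if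
one vanished, the other facets would cut out a strictly larger singular face (`exists_fract_point`).
Moreover `k ≥ 2`, because a primitive vector has no proper fractional multiple in the lattice.

The primitive vector `w` of this point, with `m • w` the point itself, goes to the new facet `E`. At
a vertex `v` of `F` the order of the local group is the absolute value of the determinant of the `n`
vectors at `v`. A vertex of `E` lies on an edge leaving `F` at `v`: exactly one facet through `F` is
exchanged for `E`, and the determinant is multiplied by `qⱼ / m`. This is nonzero, so the new
vectors are independent, and less than `1`, so the order drops (`exchange_vector`).

Each vertex of `F` is thus replaced by `k ≤ n` vertices of smaller order, and the sum of `(n + 1) ^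
order` over the vertices decreases. When no singular face is left, the vectors at every vertex form
a basis of `ℤⁿ`. Square roots of the affine coordinates at the vertex, multiplied by torus phases,
then give charts to `ℂⁿ` with smooth transitions (`contDiffOn_transition`).

The polytope combinatorics is done with inequalities. `IsSimplePolytope.exists_isSimpleHRep`
extracts from the convex hull, by polar duality, one inequality per facet such that the tight
normals at every point are independent. -/

noncomputable section

open scoped Manifold ContDiff

namespace ToricOrb

open Filter Topology

/-! ### Convex geometry: from convex hulls to irredundant inequalities. -/

section

variable {n : ℕ} {ι : Type}

/-! ### Polytopes given by inequalities -/

/-- `P` is a bounded polyhedron, cut out by the finitely many inequalities `a i x ≤ b i`. -/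
structure IsHRep (P : Set (Fin n → ℝ)) (a : ι → (Fin n → ℝ) →ₗ[ℝ] ℝ) (b : ι → ℝ) : Prop where
  finite : Finite ι
  mem_iff : ∀ x, x ∈ P ↔ ∀ i, a i x ≤ b i
  bounded : Bornology.IsBounded P

/-- The inequalities which are equalities at `x`. -/
def tightSet (a : ι → (Fin n → ℝ) →ₗ[ℝ] ℝ) (b : ι → ℝ) (x : Fin n → ℝ) : Set ι :=
  {i | a i x = b i}

/-- The points of `P` at which the inequalities in `J` are equalities. -/
def faceOf (P : Set (Fin n → ℝ)) (a : ι → (Fin n → ℝ) →ₗ[ℝ] ℝ) (b : ι → ℝ) (J : Set ι) :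
    Set (Fin n → ℝ) :=
  {x | x ∈ P ∧ J ⊆ tightSet a b x}

theorem mem_tightSet {a : ι → (Fin n → ℝ) →ₗ[ℝ] ℝ} {b : ι → ℝ} {x : Fin n → ℝ} {i : ι} :
    i ∈ tightSet a b x ↔ a i x = b i := Iff.rfl

theorem faceOf_anti {P : Set (Fin n → ℝ)} {a : ι → (Fin n → ℝ) →ₗ[ℝ] ℝ} {b : ι → ℝ}
    {J K : Set ι} (h : J ⊆ K) : faceOf P a b K ⊆ faceOf P a b J :=
  fun _ hx => ⟨hx.1, h.trans hx.2⟩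

/-- The maximizers form a compact exposed subset. It has an extreme point, and extreme points of an
extreme subset are extreme in the whole set. -/
theorem exists_extremePoint_isMaxOn {K : Set (Fin n → ℝ)} (hK : IsCompact K) (hne : K.Nonempty)
    (g : (Fin n → ℝ) →ₗ[ℝ] ℝ) :
    ∃ v ∈ K.extremePoints ℝ, ∀ x ∈ K, g x ≤ g v := by
  have hg : Continuous g := g.continuous_of_finiteDimensional
  let l : (Fin n → ℝ) →L[ℝ] ℝ := ⟨g, hg⟩
  have hexp : IsExposed ℝ K (l.toExposed K) := ContinuousLinearMap.toExposed.isExposed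
  obtain ⟨z, hz, hmax⟩ := hK.exists_isMaxOn hne hg.continuousOn
  have hne' : (l.toExposed K).Nonempty := ⟨z, hz, fun y hy => hmax hy⟩
  obtain ⟨v, hv⟩ := (hexp.isCompact hK).extremePoints_nonempty hne'
  exact ⟨v, hexp.isExtreme.extremePoints_subset_extremePoints hv,
    (extremePoints_subset hv).2⟩

namespace IsHRep

variable {P : Set (Fin n → ℝ)} {a : ι → (Fin n → ℝ) →ₗ[ℝ] ℝ} {b : ι → ℝ}

theorem isClosed (h : IsHRep P a b) : IsClosed P := by
  have : P = ⋂ i, {x | a i x ≤ b i} := by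
    ext x
    simp [h.mem_iff]
  rw [this]
  exact isClosed_iInter fun i =>
    isClosed_le (a i).continuous_of_finiteDimensional continuous_const

theorem isCompact (h : IsHRep P a b) : IsCompact P :=
  Metric.isCompact_of_isClosed_isBounded h.isClosed h.bounded

theorem convex (h : IsHRep P a b) : Convex ℝ P := by
  have : P = ⋂ i, {x | a i x ≤ b i} := by
    ext x
    simp [h.mem_iff]
  rw [this]
  exact convex_iInter fun i => convex_halfSpace_le (a i).isLinear (b i)

/-- Moving from a point of `P` in a direction which does not increase the tight functionals. -/
theorem eventually_mem (h : IsHRep P a b) {x d : Fin n → ℝ} (hx : x ∈ P)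
    (hd : ∀ i ∈ tightSet a b x, a i d ≤ 0) :
    ∀ᶠ t : ℝ in 𝓝[>] 0, x + t • d ∈ P ∧
      tightSet a b (x + t • d) = {i | i ∈ tightSet a b x ∧ a i d = 0} := by
  have := h.finite
  -- Tight constraints change by `t * a i d ≤ 0`, slack ones stay slack for small `t` by continuity.
  -- Finitely many constraints allow a common `t`.
  have key : ∀ i, ∀ᶠ t : ℝ in 𝓝[>] 0, a i (x + t • d) ≤ b i ∧
      (a i (x + t • d) = b i ↔ (a i x = b i ∧ a i d = 0)) := by
    intro i
    by_cases hi : a i x = b i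
    · filter_upwards [self_mem_nhdsWithin] with t ht
      have ht : 0 < t := ht
      have h0 := hd i hi
      simp only [map_add, map_smul, smul_eq_mul, hi, true_and, add_eq_left, mul_eq_zero, ht.ne',
        false_or, and_true]
      nlinarith
    · have hlt : a i x < b i := lt_of_le_of_ne ((h.mem_iff x).1 hx i) hi
      have hc : Continuous fun t : ℝ => a i (x + t • d) :=
        (a i).continuous_of_finiteDimensional.comp (by fun_prop)
      have h1 : ∀ᶠ t : ℝ in 𝓝 0, a i (x + t • d) < b i :=
        hc.continuousAt.eventually_lt continuousAt_const (by simpa using hlt)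
      filter_upwards [nhdsWithin_le_nhds h1] with t ht
      exact ⟨ht.le, fun e => absurd e ht.ne, fun e => absurd e.1 hi⟩
  filter_upwards [eventually_all.2 key] with t ht
  refine ⟨(h.mem_iff _).2 fun i => (ht i).1, ?_⟩
  ext i
  exact (ht i).2

theorem exists_pos_mem (h : IsHRep P a b) {x d : Fin n → ℝ} (hx : x ∈ P)
    (hd : ∀ i ∈ tightSet a b x, a i d ≤ 0) :
    ∃ t : ℝ, 0 < t ∧ x + t • d ∈ P ∧
      tightSet a b (x + t • d) = {i | i ∈ tightSet a b x ∧ a i d = 0} := by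
  obtain ⟨t, ht, h0⟩ := ((h.eventually_mem hx hd).and self_mem_nhdsWithin).exists
  exact ⟨t, h0, ht⟩

/-- The sum of the functionals in `J` is bounded on `P` by the sum of the bounds, with equality only
if every summand is tight. A point of the face shows that this bound is the maximum. -/
theorem faceOf_isExposed (h : IsHRep P a b) (J : Set ι) : IsExposed ℝ P (faceOf P a b J) := by
  classical
  have := h.finite
  have := Fintype.ofFinite ι
  intro hne
  obtain ⟨z, hz⟩ := hne
  let g : (Fin n → ℝ) →ₗ[ℝ] ℝ := ∑ i ∈ J.toFinset, a i
  refine ⟨⟨g, g.continuous_of_finiteDimensional⟩, ?_⟩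
  have hgz : g z = ∑ i ∈ J.toFinset, b i := by
    simp only [g, LinearMap.sum_apply]
    exact Finset.sum_congr rfl fun i hi => hz.2 (by simpa using hi)
  have hle : ∀ y ∈ P, g y ≤ ∑ i ∈ J.toFinset, b i := by
    intro y hy
    simp only [g, LinearMap.sum_apply]
    exact Finset.sum_le_sum fun i _ => (h.mem_iff y).1 hy i
  ext x
  constructor
  · intro hx
    refine ⟨hx.1, fun y hy => ?_⟩
    have : g x = ∑ i ∈ J.toFinset, b i := by
      simp only [g, LinearMap.sum_apply]
      exact Finset.sum_congr rfl fun i hi => hx.2 (by simpa using hi)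
    change g y ≤ g x
    rw [this]
    exact hle y hy
  · rintro ⟨hx, hmax⟩
    have hzx : g z ≤ g x := hmax z hz.1
    have heq : ∑ i ∈ J.toFinset, a i x = ∑ i ∈ J.toFinset, b i := by
      refine le_antisymm ?_ ?_
      · simpa [g] using hle x hx
      · rw [← hgz]
        simpa [g] using hzx
    rw [Finset.sum_eq_sum_iff_of_le (fun i _ => (h.mem_iff x).1 hx i)] at heq
    exact ⟨hx, fun i hi => heq i (by simpa using hi)⟩

theorem isFace_faceOf (h : IsHRep P a b) {J : Set ι} (hne : (faceOf P a b J).Nonempty) :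
    IsFace P (faceOf P a b J) :=
  ⟨h.faceOf_isExposed J, hne⟩

/-- A nonempty convex subset of `P` has a point at which only those inequalities are tight which
are tight on the whole subset. -/
theorem exists_generic (h : IsHRep P a b) {F : Set (Fin n → ℝ)} (hF : F ⊆ P) (hc : Convex ℝ F)
    (hne : F.Nonempty) : ∃ z ∈ F, ∀ i ∈ tightSet a b z, ∀ x ∈ F, i ∈ tightSet a b x := by
  classical
  have := h.finite
  have := Fintype.ofFinite ι
  obtain ⟨z0, hz0⟩ := hne
  -- For each `i` pick a point where `i` is slack, if there is one. An inequality tight at the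
  -- average of these points is tight at each of them, hence on all of `F`.
  have hex : ∀ i, ∃ y ∈ F, i ∈ tightSet a b y → ∀ x ∈ F, i ∈ tightSet a b x := by
    intro i
    by_cases hi : ∀ x ∈ F, i ∈ tightSet a b x
    · exact ⟨z0, hz0, fun _ => hi⟩
    · push Not at hi
      obtain ⟨x, hx, hx'⟩ := hi
      exact ⟨x, hx, fun e => absurd e hx'⟩
  choose y hyF hy using hex
  rcases isEmpty_or_nonempty ι with hι | hι
  · exact ⟨z0, hz0, fun i => (hι.false i).elim⟩
  let w : ι → ℝ := fun _ => (Fintype.card ι : ℝ)⁻¹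
  have hw : ∀ i, 0 < w i := fun i => by positivity
  have hw1 : ∑ i, w i = 1 := by simp [w]
  refine ⟨∑ i, w i • y i, hc.sum_mem (fun i _ => (hw i).le) hw1 (fun i _ => hyF i), ?_⟩
  intro i hi
  apply hy i
  have hi' : ∑ j, w j * a i (y j) = ∑ j, w j * b i := by
    rw [← Finset.sum_mul, hw1, one_mul]
    simpa [mem_tightSet] using hi
  rw [Finset.sum_eq_sum_iff_of_le] at hi'
  · exact mul_left_cancel₀ (hw i).ne' (hi' i (Finset.mem_univ i))
  · exact fun j _ => mul_le_mul_of_nonneg_left ((h.mem_iff _).1 (hF (hyF j)) i) (hw j).le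

/-- Every face is the set of points at which some inequalities are tight. -/
theorem eq_faceOf (h : IsHRep P a b) {F : Set (Fin n → ℝ)} (hF : IsFace P F) :
    F = faceOf P a b {i | ∀ x ∈ F, i ∈ tightSet a b x} := by
  obtain ⟨hexp, hne⟩ := hF
  obtain ⟨z, hz, hzt⟩ := h.exists_generic hexp.subset (hexp.convex h.convex) hne
  obtain ⟨l, hl⟩ := hexp hne
  apply Set.Subset.antisymm
  · exact fun x hx => ⟨hexp.subset hx, fun i hi => hi x hx⟩
  · rintro x ⟨hxP, hx⟩
    -- From the generic point `z` one can move a little away from `x` inside `P`. Since `l` is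
    -- maximal at `z`, this forces `l x ≥ l z`.
    obtain ⟨t, ht, hmem, -⟩ := h.exists_pos_mem (x := z) (d := z - x) (hexp.subset hz) (by
      intro i hi
      have h1 : a i x = b i := hx (hzt i hi)
      have h2 : a i z = b i := hi
      simp [h1, h2])
    rw [hl] at hz ⊢
    have h3 := hz.2 _ hmem
    simp only [map_add, map_smul, map_sub, smul_eq_mul] at h3
    have h4 : l z ≤ l x := by
      by_contra hcon
      push Not at hcon
      nlinarith
    exact ⟨hxP, fun y hy => (hz.2 y hy).trans h4⟩

/-- A point of `P` is an extreme point iff the normals of the tight inequalities have no common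
zero. -/
theorem mem_vertices_iff (h : IsHRep P a b) {v : Fin n → ℝ} :
    v ∈ vertices P ↔ v ∈ P ∧ ∀ d, (∀ i ∈ tightSet a b v, a i d = 0) → d = 0 := by
  constructor
  · intro hv
    have hvP : v ∈ P := hv.1.subset rfl
    refine ⟨hvP, fun d hd => ?_⟩
    obtain ⟨t, ht, hmem, htight⟩ := h.exists_pos_mem hvP (fun i hi => (hd i hi).le)
    have : v + t • d ∈ ({v} : Set (Fin n → ℝ)) := by
      rw [h.eq_faceOf hv]
      refine ⟨hmem, fun i hi => ?_⟩
      rw [htight]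
      exact ⟨hi v rfl, hd i (hi v rfl)⟩
    have h0 : t • d = 0 := by simpa using this
    exact (smul_eq_zero.1 h0).resolve_left ht.ne'
  · rintro ⟨hvP, hd⟩
    have : ({v} : Set (Fin n → ℝ)) = faceOf P a b (tightSet a b v) := by
      apply Set.Subset.antisymm
      · rintro _ rfl
        exact ⟨hvP, subset_rfl⟩
      · rintro x ⟨hx, hxt⟩
        have := hd (x - v) (fun i hi => by
          have h1 : a i x = b i := hxt hi
          have h2 : a i v = b i := hi
          simp [h1, h2])
        exact sub_eq_zero.1 this
    change IsFace P {v}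
    rw [this]
    exact h.isFace_faceOf ⟨v, hvP, subset_rfl⟩

theorem mem_vertices_iff_extreme (h : IsHRep P a b) {v : Fin n → ℝ} :
    v ∈ vertices P ↔ v ∈ P.extremePoints ℝ := by
  constructor
  · intro hv
    exact isExtreme_singleton.1 hv.1.isExtreme
  · intro hv
    have hvP := extremePoints_subset hv
    refine h.mem_vertices_iff.2 ⟨hvP, fun d hd => ?_⟩
    have e1 := h.eventually_mem hvP (d := d) (fun i hi => (hd i hi).le)
    have e2 := h.eventually_mem hvP (d := -d) (fun i hi => by simp [hd i hi])
    obtain ⟨t, ⟨h1, h2⟩, h0⟩ := ((e1.and e2).and self_mem_nhdsWithin).exists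
    have h0 : 0 < t := h0
    have := (mem_extremePoints.1 hv).2 _ h1.1 _ h2.1
      ⟨1 / 2, 1 / 2, by norm_num, by norm_num, by norm_num, by
        ext j
        simp
        ring⟩
    have h5 : t • d = 0 := by simpa using this.1
    exact (smul_eq_zero.1 h5).resolve_left h0.ne'

/-- A linear functional attains its maximum over a face at a vertex. -/
theorem exists_vertex_max (h : IsHRep P a b) {F : Set (Fin n → ℝ)} (hF : IsFace P F)
    (g : (Fin n → ℝ) →ₗ[ℝ] ℝ) : ∃ v ∈ vertices P, v ∈ F ∧ ∀ x ∈ F, g x ≤ g v := by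
  obtain ⟨v, hv, hmax⟩ := exists_extremePoint_isMaxOn (hF.1.isCompact h.isCompact) hF.2 g
  exact ⟨v, h.mem_vertices_iff_extreme.2
    (hF.1.isExtreme.extremePoints_subset_extremePoints hv), extremePoints_subset hv, hmax⟩

/-- The difference of two vertices with equal tight sets is annihilated by all tight normals.
Finiteness of the vertex set follows. -/
theorem tightSet_injOn_vertices (h : IsHRep P a b) :
    Set.InjOn (tightSet a b) (vertices P) := by
  intro v hv w _ hvw
  refine (sub_eq_zero.1 ((h.mem_vertices_iff.1 hv).2 (w - v) fun i hi => ?_)).symm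
  have h1 : a i v = b i := hi
  have h2 : a i w = b i := by
    rw [hvw] at hi
    exact hi
  simp [h1, h2]

theorem finite_vertices (h : IsHRep P a b) : (vertices P).Finite := by
  have := h.finite
  exact Set.Finite.of_finite_image (Set.toFinite _) h.tightSet_injOn_vertices

theorem eq_convexHull (h : IsHRep P a b) :
    ∃ s : Finset (Fin n → ℝ), P = convexHull ℝ (s : Set (Fin n → ℝ)) := by
  refine ⟨h.finite_vertices.toFinset, ?_⟩
  have hext : P.extremePoints ℝ = vertices P := by
    ext v
    exact h.mem_vertices_iff_extreme.symm
  have hcl : IsClosed (convexHull ℝ (vertices P)) :=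
    (h.finite_vertices.isCompact_convexHull (𝕜 := ℝ)).isClosed
  have hKM := closure_convexHull_extremePoints h.isCompact h.convex
  rw [hext, hcl.closure_eq] at hKM
  rw [Set.Finite.coe_toFinset, hKM]

end IsHRep

end

section

variable {n : ℕ} {ι : Type}

/-! ### Facets of polytopes given by inequalities -/

theorem vectorSpan_le_ker {F : Set (Fin n → ℝ)} {g : (Fin n → ℝ) →ₗ[ℝ] ℝ} {c : ℝ}
    (h : ∀ x ∈ F, g x = c) : vectorSpan ℝ F ≤ LinearMap.ker g := by
  rw [vectorSpan_def, Submodule.span_le]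
  rintro _ ⟨x, hx, y, hy, rfl⟩
  simp [h x hx, h y hy]

theorem finrank_ker_add_one {g : (Fin n → ℝ) →ₗ[ℝ] ℝ} (hg : g ≠ 0) :
    Module.finrank ℝ (LinearMap.ker g) + 1 = n := by
  have := Module.Dual.finrank_ker_add_one_of_ne_zero (K := ℝ) hg
  simpa using this

theorem vectorSpan_eq_ker {F : Set (Fin n → ℝ)} {g : (Fin n → ℝ) →ₗ[ℝ] ℝ} {c : ℝ}
    (h : ∀ x ∈ F, g x = c) (hg : g ≠ 0) (hF : Module.finrank ℝ (vectorSpan ℝ F) + 1 = n) :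
    vectorSpan ℝ F = LinearMap.ker g :=
  Submodule.eq_of_le_of_finrank_eq (vectorSpan_le_ker h)
    (by have := finrank_ker_add_one hg; omega)

theorem vectorSpan_eq_top_of_interior {P : Set (Fin n → ℝ)} (hc : Convex ℝ P)
    (h : (interior P).Nonempty) : vectorSpan ℝ P = ⊤ := by
  have h1 : affineSpan ℝ P = ⊤ :=
    affineSpan_eq_top_of_nonempty_interior (by rwa [hc.convexHull_eq])
  rw [← direction_affineSpan, h1, AffineSubspace.direction_top]

/-- Linearly independent functionals take arbitrary values. -/
theorem exists_apply_eq {E : Type*} [AddCommGroup E] [Module ℝ E] {a : ι → E →ₗ[ℝ] ℝ}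
    [Finite ι] (h : LinearIndependent ℝ a) (r : ι → ℝ) : ∃ d, ∀ i, a i d = r i := by
  classical
  have := Fintype.ofFinite ι
  suffices hs : LinearMap.range (LinearMap.pi a) = ⊤ by
    obtain ⟨d, hd⟩ := LinearMap.range_eq_top.1 hs r
    exact ⟨d, fun i => congrFun hd i⟩
  by_contra hne
  obtain ⟨f, hf, hle⟩ := Submodule.exists_le_ker_of_lt_top _ (lt_top_iff_ne_top.2 hne)
  apply hf
  -- A functional vanishing on the range of the joint evaluation map is a linear relation among the
  -- `a i`.
  have h0 : ∑ i, f (Pi.single i 1) • a i = 0 := by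
    ext x
    have h1 : f (LinearMap.pi a x) = 0 := hle ⟨x, rfl⟩
    rw [LinearMap.pi_apply_eq_sum_univ] at h1
    have h2 : ∀ i : ι, (fun j => if i = j then (1 : ℝ) else 0) = Pi.single i 1 := fun i => by
      ext j
      simp [Pi.single_apply, eq_comm]
    simpa [mul_comm, h2] using h1
  have h2 := Fintype.linearIndependent_iff.1 h _ h0
  ext i
  simpa using h2 i

theorem exists_apply_eq_on {E : Type*} [AddCommGroup E] [Module ℝ E] {a : ι → E →ₗ[ℝ] ℝ}
    {J : Set ι} (hJ : J.Finite) (h : LinearIndepOn ℝ a J) (r : ι → ℝ) :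
    ∃ d, ∀ i ∈ J, a i d = r i := by
  have := hJ.to_subtype
  obtain ⟨d, hd⟩ := exists_apply_eq h.linearIndependent (fun i : J => r i)
  exact ⟨d, fun i hi => hd ⟨i, hi⟩⟩

namespace IsHRep

variable {P : Set (Fin n → ℝ)} {a : ι → (Fin n → ℝ) →ₗ[ℝ] ℝ} {b : ι → ℝ}

/-- The direction space of a facet is a hyperplane, so it equals both the kernel of the supporting
functional and the kernel of any normal tight on the facet. Hence being tight and being a maximizer
are the same condition on points of `P`. -/
theorem eq_faceOf_of_isFacet (h : IsHRep P a b) (ha : ∀ i, a i ≠ 0)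
    (hint : (interior P).Nonempty) {F : Set (Fin n → ℝ)} (hF : IsFacet P F) :
    ∃ i, F = faceOf P a b {i} := by
  obtain ⟨⟨hexp, hne⟩, hrank⟩ := hF
  obtain ⟨l, hl⟩ := hexp hne
  obtain ⟨z, hz, hzt⟩ := h.exists_generic hexp.subset (hexp.convex h.convex) hne
  have hzP := hexp.subset hz
  have hzmax : ∀ y ∈ P, l y ≤ l z := by
    rw [hl] at hz
    exact hz.2
  have hl0 : (l : (Fin n → ℝ) →ₗ[ℝ] ℝ) ≠ 0 := by
    intro h0
    have hFP : F = P := by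
      have h0' : ∀ x, l x = 0 := fun x => LinearMap.congr_fun h0 x
      rw [hl]
      ext x
      simp [h0']
    rw [hFP, vectorSpan_eq_top_of_interior h.convex hint] at hrank
    simp at hrank
  have hFl : ∀ x ∈ F, (l : (Fin n → ℝ) →ₗ[ℝ] ℝ) x = l z := by
    intro x hx
    rw [hl] at hx
    exact le_antisymm (hzmax x hx.1) (hx.2 z hzP)
  have hk1 := vectorSpan_eq_ker hFl hl0 hrank
  have hex : (tightSet a b z).Nonempty := by
    rw [Set.nonempty_iff_ne_empty]
    -- Without tight inequalities at `z` every direction is feasible, so a functional maximal at `z`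
    -- vanishes.
    intro hem
    apply hl0
    have hle : ∀ d, l d ≤ 0 := by
      intro d
      obtain ⟨t, ht, hmem, -⟩ := h.exists_pos_mem (d := d) hzP (by simp [hem])
      have := hzmax _ hmem
      simp only [map_add, map_smul, smul_eq_mul] at this
      by_contra hcon
      push Not at hcon
      nlinarith
    refine LinearMap.ext fun d => le_antisymm (hle _) ?_
    have := hle (-d)
    simpa using this
  obtain ⟨i, hi⟩ := hex
  refine ⟨i, Set.Subset.antisymm (fun x hx => ⟨hexp.subset hx, ?_⟩) ?_⟩
  · rintro _ rfl
    exact hzt _ hi x hx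
  · rintro x ⟨hxP, hx⟩
    have hk2 := vectorSpan_eq_ker (g := a i) (c := b i) (fun x hx => hzt i hi x hx) (ha i) hrank
    have h1 : x - z ∈ LinearMap.ker (a i) := by
      have h1 : a i x = b i := hx rfl
      have h2 : a i z = b i := hi
      simp [h1, h2]
    rw [← hk2, hk1] at h1
    have h2 : l x = l z := by simpa [sub_eq_zero] using h1
    rw [hl]
    exact ⟨hxP, fun y hy => h2 ▸ hzmax y hy⟩

/-- At a point where only `i` is tight, one can move inside the face along every direction of the
kernel of `a i`. -/
theorem isFacet_faceOf (h : IsHRep P a b) {i : ι} (hi : a i ≠ 0) {z : Fin n → ℝ} (hz : z ∈ P)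
    (hzt : tightSet a b z = {i}) : IsFacet P (faceOf P a b {i}) := by
  have hzF : z ∈ faceOf P a b {i} := ⟨hz, hzt.ge⟩
  refine ⟨h.isFace_faceOf ⟨z, hzF⟩, ?_⟩
  suffices hs : vectorSpan ℝ (faceOf P a b {i}) = LinearMap.ker (a i) by
    rw [hs]
    exact finrank_ker_add_one hi
  apply le_antisymm
  · exact vectorSpan_le_ker fun x hx => hx.2 rfl
  · intro d hd
    have hd : a i d = 0 := hd
    obtain ⟨t, ht, hmem, htight⟩ := h.exists_pos_mem (d := d) hz (by
      rw [hzt]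
      rintro _ rfl
      exact hd.le)
    have h1 : z + t • d ∈ faceOf P a b {i} := by
      refine ⟨hmem, ?_⟩
      rintro _ rfl
      rw [htight, hzt]
      exact ⟨rfl, hd⟩
    have h2 := vsub_mem_vectorSpan ℝ h1 hzF
    simp only [vsub_eq_sub, add_sub_cancel_left] at h2
    exact (Submodule.smul_mem_iff _ ht.ne').1 h2

end IsHRep

/-! ### Simple polytopes given by inequalities -/

/-- An irredundant presentation of a simple polytope by inequalities. -/
structure IsSimpleHRep (P : Set (Fin n → ℝ)) (a : ι → (Fin n → ℝ) →ₗ[ℝ] ℝ) (b : ι → ℝ) : Prop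
    extends IsHRep P a b where
  nonempty : P.Nonempty
  indep : ∀ x ∈ P, LinearIndepOn ℝ a (tightSet a b x)
  exists_tight : ∀ i, ∃ x ∈ P, i ∈ tightSet a b x

namespace IsSimpleHRep

variable {P : Set (Fin n → ℝ)} {a : ι → (Fin n → ℝ) →ₗ[ℝ] ℝ} {b : ι → ℝ}

theorem exists_dir (h : IsSimpleHRep P a b) {x : Fin n → ℝ} (hx : x ∈ P) (r : ι → ℝ) :
    ∃ d, ∀ i ∈ tightSet a b x, a i d = r i := by
  have := h.finite
  exact exists_apply_eq_on (Set.toFinite _) (h.indep x hx) r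

theorem ne_zero (h : IsSimpleHRep P a b) (i : ι) : a i ≠ 0 := by
  obtain ⟨x, hx, hi⟩ := h.exists_tight i
  exact (h.indep x hx).ne_zero hi

/-- Independence of the tight normals gives a direction that keeps `J` tight and loosens all other
tight inequalities at once. -/
theorem exists_tightSet_eq (h : IsSimpleHRep P a b) {x : Fin n → ℝ} (hx : x ∈ P) {J : Set ι}
    (hJ : J ⊆ tightSet a b x) : ∃ z ∈ P, tightSet a b z = J := by
  classical
  obtain ⟨d, hd⟩ := h.exists_dir hx (fun i => if i ∈ J then 0 else -1)
  obtain ⟨t, -, hmem, ht⟩ := h.exists_pos_mem (d := d) hx (by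
    intro i hi
    rw [hd i hi]
    split_ifs <;> norm_num)
  refine ⟨_, hmem, ht.trans ?_⟩
  ext i
  constructor
  · rintro ⟨h1, h2⟩
    rw [hd i h1] at h2
    by_contra hi
    simp [hi] at h2
  · intro hi
    exact ⟨hJ hi, by simp [hd i (hJ hi), hi]⟩

theorem interior_nonempty (h : IsSimpleHRep P a b) : (interior P).Nonempty := by
  obtain ⟨x, hx⟩ := h.nonempty
  obtain ⟨z, hz, hzt⟩ := h.exists_tightSet_eq hx (Set.empty_subset _)
  have := h.finite
  refine ⟨z, mem_interior.2 ⟨⋂ i, {x | a i x < b i}, ?_, ?_, ?_⟩⟩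
  · intro y hy
    rw [h.mem_iff]
    exact fun i => (Set.mem_iInter.1 hy i).le
  · exact isOpen_iInter_of_finite fun i =>
      isOpen_lt (a i).continuous_of_finiteDimensional continuous_const
  · refine Set.mem_iInter.2 fun i => lt_of_le_of_ne ((h.mem_iff z).1 hz i) fun e => ?_
    have : i ∈ tightSet a b z := e
    simp [hzt] at this

theorem isFacet (h : IsSimpleHRep P a b) (i : ι) : IsFacet P (faceOf P a b {i}) := by
  obtain ⟨x, hx, hi⟩ := h.exists_tight i
  obtain ⟨z, hz, hzt⟩ := h.exists_tightSet_eq hx (Set.singleton_subset_iff.2 hi)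
  exact h.isFacet_faceOf (h.ne_zero i) hz hzt

theorem faceOf_subset_faceOf_iff (h : IsSimpleHRep P a b) {J K : Set ι}
    (hJ : (faceOf P a b J).Nonempty) : faceOf P a b J ⊆ faceOf P a b K ↔ K ⊆ J := by
  refine ⟨fun hs => ?_, faceOf_anti⟩
  obtain ⟨x, hx⟩ := hJ
  obtain ⟨z, hz, hzt⟩ := h.exists_tightSet_eq hx.1 hx.2
  have := (hs ⟨hz, hzt.ge⟩).2
  rwa [hzt] at this

theorem faceOf_singleton_injective (h : IsSimpleHRep P a b) :
    Function.Injective fun i => faceOf P a b {i} := by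
  intro i j hij
  have := (h.faceOf_subset_faceOf_iff (K := {j}) (h.isFacet i).1.2).1 hij.le
  exact (this rfl).symm

/-- The facets correspond to the inequalities. -/
def facetEquiv (h : IsSimpleHRep P a b) : ι ≃ {F : Set (Fin n → ℝ) // IsFacet P F} :=
  Equiv.ofBijective (fun i => ⟨faceOf P a b {i}, h.isFacet i⟩)
    ⟨fun i j hij => h.faceOf_singleton_injective (congrArg Subtype.val hij), fun F => by
      obtain ⟨i, hi⟩ := h.eq_faceOf_of_isFacet h.ne_zero h.interior_nonempty F.2
      exact ⟨i, Subtype.ext hi.symm⟩⟩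

theorem mem_facetEquiv (h : IsSimpleHRep P a b) {i : ι} {x : Fin n → ℝ} :
    x ∈ (h.facetEquiv i).1 ↔ x ∈ P ∧ i ∈ tightSet a b x := by
  change x ∈ P ∧ {i} ⊆ tightSet a b x ↔ _
  simp

/-- A point is a vertex iff exactly `n` inequalities are tight. -/
theorem mem_vertices_iff_ncard (h : IsSimpleHRep P a b) {v : Fin n → ℝ} :
    v ∈ vertices P ↔ v ∈ P ∧ (tightSet a b v).ncard = n := by
  classical
  rw [h.mem_vertices_iff]
  refine and_congr_right fun hv => ?_
  have := h.finite
  have := Fintype.ofFinite ι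
  -- By independence this map is onto, so it is injective exactly when the dimensions agree.
  let φ : (Fin n → ℝ) →ₗ[ℝ] (tightSet a b v → ℝ) := LinearMap.pi fun i => a i.1
  have hsurj : Function.Surjective φ := fun r => by
    obtain ⟨d, hd⟩ := exists_apply_eq (h.indep v hv).linearIndependent r
    exact ⟨d, funext hd⟩
  have hcard : (tightSet a b v).ncard = Module.finrank ℝ (tightSet a b v → ℝ) := by
    rw [Module.finrank_fintype_fun_eq_card, ← Nat.card_eq_fintype_card, Nat.card_coe_set_eq]
  have hn : Module.finrank ℝ (Fin n → ℝ) = n := by simp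
  have hker : (∀ d, (∀ i ∈ tightSet a b v, a i d = 0) → d = 0) ↔ Function.Injective φ := by
    rw [injective_iff_map_eq_zero]
    refine forall_congr' fun d => imp_congr_left ⟨fun hd => funext fun i => hd i.1 i.2,
      fun hd i hi => congrFun hd ⟨i, hi⟩⟩
  rw [hker, hcard]
  constructor
  · intro hinj
    rw [← (LinearEquiv.ofBijective φ ⟨hinj, hsurj⟩).finrank_eq, hn]
  · intro he
    exact (LinearMap.injective_iff_surjective_of_finrank_eq_finrank (hn.trans he.symm)).2 hsurj

theorem isSimplePolytope (h : IsSimpleHRep P a b) : IsSimplePolytope P where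
  exists_convexHull := h.eq_convexHull
  interior_nonempty := h.interior_nonempty
  ncard_facets v hv := by
    obtain ⟨hvP, hn⟩ := h.mem_vertices_iff_ncard.1 hv
    refine Eq.trans (Eq.symm ?_) hn
    refine Set.ncard_congr (fun i _ => faceOf P a b {i}) (fun i hi => ?_)
      (fun i j _ _ hij => h.faceOf_singleton_injective hij) ?_
    · exact ⟨h.isFacet i, hvP, Set.singleton_subset_iff.2 hi⟩
    · rintro F ⟨hF, hvF⟩
      obtain ⟨i, rfl⟩ := h.eq_faceOf_of_isFacet h.ne_zero h.interior_nonempty hF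
      exact ⟨i, hvF.2 rfl, rfl⟩

end IsSimpleHRep

end

section

variable {n : ℕ} {ι : Type}

/-! ### Every simple polytope has a presentation by inequalities -/

/-- The linear functional `x ↦ ∑ i, u i * x i`. -/
def dotLin (u : Fin n → ℝ) : (Fin n → ℝ) →ₗ[ℝ] ℝ := ∑ i, u i • LinearMap.proj i

theorem dotLin_apply (u x : Fin n → ℝ) : dotLin u x = ∑ i, u i * x i := by
  simp [dotLin]

theorem dotLin_comm (u x : Fin n → ℝ) : dotLin u x = dotLin x u := by
  simp [dotLin_apply, mul_comm]

theorem exists_eq_dotLin (g : (Fin n → ℝ) →ₗ[ℝ] ℝ) : ∃ u, g = dotLin u := by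
  refine ⟨fun i => g (Pi.single i 1), ?_⟩
  ext i
  simp [dotLin_apply, Pi.single_apply]

/-- The polar of a finite set with respect to `p`. -/
def polar (s : Finset (Fin n → ℝ)) (p : Fin n → ℝ) : Set (Fin n → ℝ) :=
  {f | ∀ y ∈ s, dotLin f (y - p) ≤ 1}

section polar

variable {s : Finset (Fin n → ℝ)} {p : Fin n → ℝ}

theorem dotLin_le_one_of_mem_polar {f x : Fin n → ℝ} (hf : f ∈ polar s p)
    (hx : x ∈ convexHull ℝ (s : Set (Fin n → ℝ))) : dotLin f (x - p) ≤ 1 := by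
  have hsub : convexHull ℝ (s : Set (Fin n → ℝ)) ⊆ {x | dotLin f x ≤ 1 + dotLin f p} := by
    refine convexHull_min (fun y hy => ?_) (convex_halfSpace_le (dotLin f).isLinear _)
    have := hf y hy
    rw [map_sub] at this
    change dotLin f y ≤ _
    linarith
  have : dotLin f x ≤ 1 + dotLin f p := hsub hx
  rw [map_sub]
  linarith

/-- Boundedness: if a ball of radius `r` about `p` lies in the hull, testing `f` at `p ± (r / 2) eᵢ`
gives `|f i| ≤ 2 / r`. -/
theorem isHRep_polar (hp : p ∈ interior (convexHull ℝ (s : Set (Fin n → ℝ)))) :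
    IsHRep (polar s p) (fun y : s => dotLin (y.1 - p)) (fun _ => 1) where
  finite := inferInstance
  mem_iff f := by
    simp only [polar, Set.mem_ofPred_eq, Subtype.forall, dotLin_comm f]
  bounded := by
    obtain ⟨r, hr, hball⟩ := Metric.mem_nhds_iff.1 (mem_interior_iff_mem_nhds.1 hp)
    refine isBounded_iff_forall_norm_le.2 ⟨2 / r, fun f hf => ?_⟩
    refine (pi_norm_le_iff_of_nonneg (by positivity)).2 fun i => ?_
    have key : ∀ e : ℝ, |e| = r / 2 → e * f i ≤ 1 := by
      intro e he
      have h1 : p + Pi.single i e ∈ convexHull ℝ (s : Set (Fin n → ℝ)) := by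
        apply hball
        rw [Metric.mem_ball, dist_eq_norm, add_sub_cancel_left, Pi.norm_single, Real.norm_eq_abs,
          he]
        linarith
      have h2 := dotLin_le_one_of_mem_polar hf h1
      rw [add_sub_cancel_left, dotLin_apply] at h2
      simpa [Pi.single_apply, mul_comm] using h2
    have h1 := key (r / 2) (abs_of_pos (by positivity))
    have h2 := key (-(r / 2)) (by rw [abs_neg]; exact abs_of_pos (by positivity))
    rw [Real.norm_eq_abs, abs_le]
    constructor
    · rw [neg_le, le_div_iff₀ hr]
      linarith
    · rw [le_div_iff₀ hr]
      linarith

/-- A functional separating `x` from the hull, rescaled, lies in the polar and exceeds `1` at `x -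
p`. Evaluation at `x - p` is linear on the polar, so its maximum is attained at a vertex. -/
theorem exists_vertex_polar (hp : p ∈ interior (convexHull ℝ (s : Set (Fin n → ℝ))))
    {x : Fin n → ℝ} (hx : x ∉ convexHull ℝ (s : Set (Fin n → ℝ))) :
    ∃ f ∈ vertices (polar s p), 1 < dotLin f (x - p) := by
  have hcl : IsClosed (convexHull ℝ (s : Set (Fin n → ℝ))) :=
    (s.finite_toSet.isCompact_convexHull (𝕜 := ℝ)).isClosed
  obtain ⟨l, u, hlu, hux⟩ := geometric_hahn_banach_closed_point (convex_convexHull ℝ _) hcl hx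
  have hpos : 0 < u - l p := sub_pos.2 (hlu p (interior_subset hp))
  obtain ⟨g, hg⟩ := exists_eq_dotLin ((u - l p)⁻¹ • (l : (Fin n → ℝ) →ₗ[ℝ] ℝ))
  have hgx : ∀ y, dotLin g y = (u - l p)⁻¹ * l y := fun y => by
    rw [← hg]
    simp
  have hgK : g ∈ polar s p := by
    intro y hy
    have := hlu y (subset_convexHull ℝ _ hy)
    rw [hgx, map_sub, inv_mul_le_iff₀ hpos]
    linarith
  obtain ⟨f, hf, -, hmax⟩ := (isHRep_polar hp).exists_vertex_max (F := polar s p)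
    ⟨IsExposed.refl _, ⟨g, hgK⟩⟩ (dotLin (x - p))
  refine ⟨f, hf, lt_of_lt_of_le ?_ ((hmax g hgK).trans_eq (dotLin_comm _ _))⟩
  rw [dotLin_comm, hgx, map_sub, lt_inv_mul_iff₀ hpos]
  linarith

theorem isHRep_of_polar (hp : p ∈ interior (convexHull ℝ (s : Set (Fin n → ℝ)))) :
    IsHRep (convexHull ℝ (s : Set (Fin n → ℝ))) (fun f : vertices (polar s p) => dotLin f.1)
      (fun f => 1 + dotLin f.1 p) where
  finite := (isHRep_polar hp).finite_vertices.to_subtype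
  bounded := (s.finite_toSet.isCompact_convexHull (𝕜 := ℝ)).isBounded
  mem_iff x := by
    constructor
    · rintro hx ⟨f, hf⟩
      have := dotLin_le_one_of_mem_polar (hf.1.subset rfl) hx
      rw [map_sub] at this
      dsimp only
      linarith
    · intro h
      by_contra hx
      obtain ⟨f, hf, hlt⟩ := exists_vertex_polar hp hx
      have := h ⟨f, hf⟩
      rw [map_sub] at hlt
      dsimp only at this
      linarith

/-- The vertex criterion read dually: the vectors `y - p` on which a vertex `f` of the polar takes
the value `1` span the space. -/
theorem eq_zero_of_mem_vertices_polar (hp : p ∈ interior (convexHull ℝ (s : Set (Fin n → ℝ))))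
    {f d : Fin n → ℝ} (hf : f ∈ vertices (polar s p))
    (hd : ∀ y ∈ s, dotLin f (y - p) = 1 → dotLin d (y - p) = 0) : d = 0 := by
  refine ((isHRep_polar hp).mem_vertices_iff.1 hf).2 d ?_
  rintro ⟨y, hy⟩ hty
  rw [mem_tightSet, dotLin_comm] at hty
  rw [dotLin_comm]
  exact hd y hy hty

/-- The points of `s` tight for `f` span, relative to `p`, the whole space. Relative to one of them
they therefore span at least dimension `n - 1`, and no more because `dotLin f` is constant on them.
-/
theorem isFacet_of_polar (hn : 1 ≤ n)
    (hp : p ∈ interior (convexHull ℝ (s : Set (Fin n → ℝ)))) (f : vertices (polar s p)) :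
    IsFacet (convexHull ℝ (s : Set (Fin n → ℝ)))
      (faceOf (convexHull ℝ (s : Set (Fin n → ℝ))) (fun f : vertices (polar s p) => dotLin f.1)
      (fun f => 1 + dotLin f.1 p) {f}) := by
  set G := faceOf (convexHull ℝ (s : Set (Fin n → ℝ)))
    (fun f : vertices (polar s p) => dotLin f.1) (fun f => 1 + dotLin f.1 p) {f} with hG
  have hmemG : ∀ y ∈ s, dotLin f.1 (y - p) = 1 → y ∈ G := by
    intro y hy hty
    refine ⟨subset_convexHull ℝ _ hy, ?_⟩
    rintro _ rfl
    rw [map_sub] at hty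
    rw [mem_tightSet]
    linarith
  obtain ⟨y₀, hy₀, hty₀⟩ : ∃ y ∈ s, dotLin f.1 (y - p) = 1 := by
    by_contra hcon
    push Not at hcon
    -- With no tight point every `d` would be zero, which is absurd for the all-ones vector since `1
    -- ≤ n`.
    have := eq_zero_of_mem_vertices_polar hp f.2 (d := fun _ => 1)
      (fun y hy h => absurd h (hcon y hy))
    have := congrFun this ⟨0, hn⟩
    simp at this
  refine ⟨(isHRep_of_polar hp).isFace_faceOf ⟨y₀, hmemG y₀ hy₀ hty₀⟩, ?_⟩
  have hf0 : dotLin f.1 ≠ 0 := by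
    intro h0
    rw [h0] at hty₀
    simp at hty₀
  have hle := Submodule.finrank_mono (vectorSpan_le_ker (F := G) (g := dotLin f.1)
    (c := 1 + dotLin f.1 p) fun x hx => hx.2 rfl)
  have hker := finrank_ker_add_one hf0
  have htop : vectorSpan ℝ G ⊔ Submodule.span ℝ {y₀ - p} = ⊤ := by
    by_contra hne
    obtain ⟨φ, hφ, hφle⟩ := Submodule.exists_le_ker_of_lt_top _ (lt_top_iff_ne_top.2 hne)
    obtain ⟨d, rfl⟩ := exists_eq_dotLin φ
    apply hφ
    have hd : d = 0 := by
      refine eq_zero_of_mem_vertices_polar hp f.2 fun y hy hty => ?_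
      have h1 : y - y₀ ∈ vectorSpan ℝ G :=
        vsub_mem_vectorSpan ℝ (hmemG y hy hty) (hmemG y₀ hy₀ hty₀)
      have h2 : dotLin d (y - y₀) = 0 := hφle (Submodule.mem_sup_left h1)
      have h3 : dotLin d (y₀ - p) = 0 :=
        hφle (Submodule.mem_sup_right (Submodule.mem_span_singleton_self _))
      rw [map_sub] at h2 h3 ⊢
      linarith
    ext i
    simp [hd, dotLin_apply]
  have h1 := Submodule.finrank_add_le_finrank_add_finrank (vectorSpan ℝ G)
    (Submodule.span ℝ {y₀ - p})
  rw [htop, finrank_top, Module.finrank_fin_fun] at h1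
  have h2 := finrank_span_singleton (K := ℝ) (v := y₀ - p) (by
    intro h0
    rw [h0] at hty₀
    simp at hty₀)
  omega

theorem faceOf_polar_injective (hp : p ∈ interior (convexHull ℝ (s : Set (Fin n → ℝ)))) :
    Function.Injective fun f : vertices (polar s p) =>
      faceOf (convexHull ℝ (s : Set (Fin n → ℝ))) (fun f : vertices (polar s p) => dotLin f.1)
      (fun f => 1 + dotLin f.1 p) {f} := by
  intro f g hfg
  apply Subtype.ext
  rw [← sub_eq_zero]
  refine eq_zero_of_mem_vertices_polar hp f.2 fun y hy hty => ?_
  have h1 : dotLin f.1 y = 1 + dotLin f.1 p := by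
    rw [map_sub] at hty
    linarith
  have hy' : y ∈ faceOf (convexHull ℝ (s : Set (Fin n → ℝ)))
      (fun f : vertices (polar s p) => dotLin f.1) (fun f => 1 + dotLin f.1 p) {f} :=
    ⟨subset_convexHull ℝ _ hy, by
      rintro _ rfl
      exact h1⟩
  have hy'' := hfg.le hy'
  have h2 : dotLin g.1 y = 1 + dotLin g.1 p := hy''.2 rfl
  rw [dotLin_comm, map_sub, dotLin_comm _ f.1, dotLin_comm _ g.1, map_sub, map_sub]
  linarith

end polar

theorem IsSimpleHRep.reindex {κ : Type} {P : Set (Fin n → ℝ)} {a : ι → (Fin n → ℝ) →ₗ[ℝ] ℝ}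
    {b : ι → ℝ} (h : IsSimpleHRep P a b) (e : κ ≃ ι) : IsSimpleHRep P (a ∘ e) (b ∘ e) where
  finite := by
    have := h.finite
    exact Finite.of_equiv ι e.symm
  mem_iff x := by
    rw [h.mem_iff]
    exact e.forall_congr_right.symm
  bounded := h.bounded
  nonempty := h.nonempty
  indep x hx := by
    have h1 : e '' tightSet (a ∘ e) (b ∘ e) x = tightSet a b x := by
      ext i
      simp only [Set.mem_image, mem_tightSet, Function.comp]
      exact ⟨by rintro ⟨j, hj, rfl⟩; exact hj, fun hi => ⟨e.symm i, by simpa using hi, by simp⟩⟩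
    rw [linearIndepOn_equiv, h1]
    exact h.indep x hx
  exists_tight i := h.exists_tight (e i)

/-- A simple polytope is presented by inequalities indexed by its facets. -/
theorem IsSimplePolytope.exists_isSimpleHRep (hn : 1 ≤ n) {P : Set (Fin n → ℝ)}
    (hP : IsSimplePolytope P) :
    ∃ (a : {F // IsFacet P F} → (Fin n → ℝ) →ₗ[ℝ] ℝ) (b : {F // IsFacet P F} → ℝ),
      IsSimpleHRep P a b ∧ ∀ F x, x ∈ F.1 ↔ x ∈ P ∧ F ∈ tightSet a b x := by
  obtain ⟨⟨s, rfl⟩, ⟨p, hp⟩, hfac⟩ := hP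
  set P := convexHull ℝ (s : Set (Fin n → ℝ)) with hPdef
  set a := fun f : vertices (polar s p) => dotLin f.1 with ha
  set b := fun f : vertices (polar s p) => 1 + dotLin f.1 p with hb
  have h : IsHRep P a b := isHRep_of_polar hp
  have hfin := h.finite
  have hfacet : ∀ f, IsFacet P (faceOf P a b {f}) := isFacet_of_polar hn hp
  have hinj : Function.Injective fun f => faceOf P a b {f} := faceOf_polar_injective hp
  have ha0 : ∀ f, a f ≠ 0 := by
    intro f h0
    have h1 : f.1 = 0 := by
      ext i
      have := LinearMap.congr_fun h0 (Pi.single i 1)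
      simpa [ha, dotLin_apply, Pi.single_apply] using this
    obtain ⟨x, -, hx⟩ := (hfacet f).1.2
    have hx : a f x = b f := hx rfl
    rw [h0, hb] at hx
    simp [h1, dotLin_apply] at hx
  have hcard : ∀ v ∈ vertices P, (tightSet a b v).ncard = n := by
    intro v hv
    refine Eq.trans ?_ (hfac v hv)
    refine Set.ncard_congr (fun i _ => faceOf P a b {i}) (fun i hi => ?_)
      (fun i j _ _ hij => hinj hij) ?_
    · exact ⟨hfacet i, hv.1.subset rfl, Set.singleton_subset_iff.2 hi⟩
    · rintro F ⟨hF, hvF⟩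
      obtain ⟨i, rfl⟩ := h.eq_faceOf_of_isFacet ha0 ⟨p, hp⟩ hF
      exact ⟨i, hvF.2 rfl, rfl⟩
  have hS : IsSimpleHRep P a b :=
    { h with
      nonempty := ⟨p, interior_subset hp⟩
      exists_tight := fun i => by
        obtain ⟨x, hx⟩ := (hfacet i).1.2
        exact ⟨x, hx.1, hx.2 rfl⟩
      indep := fun x hx => by
        classical
        obtain ⟨v, hv, hvx, -⟩ := h.exists_vertex_max
          (h.isFace_faceOf (J := tightSet a b x) ⟨x, hx, subset_rfl⟩) 0
        refine LinearIndepOn.mono ?_ hvx.2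
        -- The tight normals at a vertex have no common zero, so they span the dual space.
        -- Simplicity says there are `n` of them, so they form a basis.
        have := Fintype.ofFinite (tightSet a b v)
        refine linearIndependent_of_top_le_span_of_card_eq_finrank ?_ ?_
        · rintro g -
          refine mem_span_of_iInf_ker_le_ker fun d hd => ?_
          have hd0 : d = 0 := (h.mem_vertices_iff.1 hv).2 d fun i hi => by
            simpa using (Submodule.mem_iInf _).1 hd ⟨i, hi⟩
          simp [hd0]
        · rw [← Nat.card_eq_fintype_card, Nat.card_coe_set_eq, hcard v hv,
            Subspace.dual_finrank_eq, Module.finrank_fin_fun] }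
  refine ⟨_, _, hS.reindex hS.facetEquiv.symm, fun F x => ?_⟩
  obtain ⟨i, rfl⟩ := hS.facetEquiv.surjective F
  rw [hS.mem_facetEquiv]
  simp [mem_tightSet]

end

/-! ### Lattice arithmetic: saturation, fractional points, determinants. -/

section

variable {n : ℕ}

/-! ### Lattice vectors -/

/-- The order of `((⟨S⟩ ⊗ ℝ) ∩ ℤⁿ) / ⟨S⟩`. -/
def quotOrder (S : Set (Fin n → ℤ)) : ℕ :=
  Nat.card (saturation S ⧸ (Submodule.span ℤ S).comap (saturation S).subtype)

theorem quotOrder_eq_one_iff {S : Set (Fin n → ℤ)} :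
    quotOrder S = 1 ↔ saturation S ≤ Submodule.span ℤ S := by
  rw [quotOrder, Nat.card_eq_one_iff_unique, Submodule.Quotient.subsingleton_iff,
    Submodule.comap_subtype_eq_top]
  exact and_iff_left ⟨0⟩

/-- Integer vectors in the real span of integer vectors are rational combinations of them. -/
theorem exists_rat_of_mem_saturation {κ : Type*} [Fintype κ] {u : κ → Fin n → ℤ}
    (hu : LinearIndependent ℤ u) {v : Fin n → ℤ} (hv : v ∈ saturation (Set.range u)) :
    ∃ q : κ → ℚ, ∀ a, (v a : ℚ) = ∑ i, q i * (u i a : ℚ) := by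
  have huQ : LinearIndependent ℚ (fun i => algebraMap ℤ ℚ ∘ u i) :=
    linearIndependent_algebraMap_comp_iff.2 hu
  have hmem : algebraMap ℤ ℚ ∘ v ∈ Submodule.span ℚ (Set.range fun i => algebraMap ℤ ℚ ∘ u i) := by
    -- Independence of integer vectors is the same over `ℤ`, `ℚ` and `ℝ`. Were `v` outside the
    -- rational span, adjoining it would keep independence over `ℝ`, against `hv`.
    by_contra hnot
    have h1 := linearIndependent_option'.2 ⟨huQ, hnot⟩
    have h2 : LinearIndependent ℤ (fun o : Option κ => Option.casesOn' o v u) := by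
      rw [← linearIndependent_algebraMap_comp_iff (S := ℚ)]
      have h1' : (fun o : Option κ => algebraMap ℤ ℚ ∘ (Option.casesOn' o v u : Fin n → ℤ)) =
          fun o => Option.casesOn' o (algebraMap ℤ ℚ ∘ v) fun i => algebraMap ℤ ℚ ∘ u i := by
        ext1 o
        cases o <;> rfl
      rw [h1']
      exact h1
    have h3 : LinearIndependent ℝ
        (fun o : Option κ => algebraMap ℤ ℝ ∘ (Option.casesOn' o v u : Fin n → ℤ)) :=
      linearIndependent_algebraMap_comp_iff.2 h2
    have h4 : LinearIndependent ℝ (fun o : Option κ =>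
        Option.casesOn' o (algebraMap ℤ ℝ ∘ v) fun i => algebraMap ℤ ℝ ∘ u i) := by
      convert h3 using 2 with o
      cases o <;> rfl
    refine (linearIndependent_option'.1 h4).2 ?_
    rw [saturation, ← Set.range_comp] at hv
    exact hv
  obtain ⟨q, hq⟩ := (Submodule.mem_span_range_iff_exists_fun ℚ).1 hmem
  refine ⟨q, fun a => ?_⟩
  have := congrFun hq a
  simpa using this.symm

theorem mem_saturation_of_rat {κ : Type*} [Fintype κ] {u : κ → Fin n → ℤ} {v : Fin n → ℤ}
    (q : κ → ℚ) (hq : ∀ a, (v a : ℚ) = ∑ i, q i * (u i a : ℚ)) :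
    v ∈ saturation (Set.range u) := by
  change intCast n v ∈ Submodule.span ℝ (intCast n '' Set.range u)
  have : intCast n v = ∑ i, (q i : ℝ) • intCast n (u i) := by
    ext a
    have h1 : ((v a : ℚ) : ℝ) = ((∑ i, q i * (u i a : ℚ) : ℚ) : ℝ) := by rw [hq a]
    push_cast at h1
    simpa [intCast] using h1
  rw [this]
  exact Submodule.sum_mem _ fun i _ => Submodule.smul_mem _ _
    (Submodule.subset_span ⟨_, ⟨i, rfl⟩, rfl⟩)

/-- If independent vectors span a proper sublattice of their saturation, but proper subsets of
them do not, then there is a lattice point with all coefficients strictly between `0` and `1`. -/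
theorem exists_fract_point {κ : Type*} [Fintype κ] {u : κ → Fin n → ℤ}
    (hu : LinearIndependent ℤ u)
    (hsing : ¬ saturation (Set.range u) ≤ Submodule.span ℤ (Set.range u))
    (hmin : ∀ J : Set κ, J ≠ Set.univ → saturation (u '' J) ≤ Submodule.span ℤ (u '' J)) :
    ∃ (q : κ → ℚ) (v : Fin n → ℤ), (∀ j, 0 < q j ∧ q j < 1) ∧ v ≠ 0 ∧
      ∀ a, (v a : ℚ) = ∑ j, q j * (u j a : ℚ) := by
  classical
  obtain ⟨w, hw, hws⟩ := Set.not_subset.1 hsing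
  obtain ⟨r, hr⟩ := exists_rat_of_mem_saturation hu hw
  set z : Fin n → ℤ := ∑ j, ⌊r j⌋ • u j with hz
  have hzs : z ∈ Submodule.span ℤ (Set.range u) :=
    Submodule.sum_mem _ fun j _ => Submodule.smul_mem _ _ (Submodule.subset_span ⟨j, rfl⟩)
  have hvs : w - z ∉ Submodule.span ℤ (Set.range u) := fun h => hws (by
    simpa using Submodule.add_mem _ h hzs)
  have hq : ∀ a, ((w - z) a : ℚ) = ∑ j, Int.fract (r j) * (u j a : ℚ) := by
    intro a
    simp only [Pi.sub_apply, Int.cast_sub, hr a, hz, Finset.sum_apply, Pi.smul_apply, smul_eq_mul,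
      Int.cast_sum, Int.cast_mul, ← Finset.sum_sub_distrib, Int.fract, sub_mul]
  refine ⟨fun j => Int.fract (r j), w - z, fun j => ⟨?_, Int.fract_lt_one _⟩, ?_, hq⟩
  -- A zero coefficient would put `w - z` in the saturation of a proper subset, hence in its integer
  -- span by `hmin`.
  · refine lt_of_le_of_ne (Int.fract_nonneg _) fun (h0 : 0 = Int.fract (r j)) => hvs ?_
    let J : Set κ := {i | i ≠ j}
    have hJ : J ≠ Set.univ := fun h => by
      have : j ∈ J := h ▸ Set.mem_univ j
      exact this rfl
    refine Submodule.span_mono (Set.image_subset_range u J) (hmin J hJ ?_)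
    rw [Set.image_eq_range]
    refine mem_saturation_of_rat (fun i : J => Int.fract (r i)) fun a => ?_
    rw [hq a]
    refine (Finset.sum_subset (Finset.subset_univ (Finset.univ.erase j)) ?_).symm.trans ?_
    · intro i _ hi
      have hij : i = j := by simpa using hi
      rw [hij, ← h0, zero_mul]
    · exact Finset.sum_subtype _ (fun i => by simp [J]) _
  · intro h0
    exact hvs (h0 ▸ Submodule.zero_mem _)

/-- Every nonzero lattice vector is a positive multiple of a primitive one. -/
theorem exists_primitive {v : Fin n → ℤ} (hv : v ≠ 0) :
    ∃ (m : ℕ) (w : Fin n → ℤ), 0 < m ∧ IsPrimitiveVec w ∧ v = m • w := by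
  obtain ⟨i₀, hi₀⟩ := Function.ne_iff.1 hv
  obtain ⟨g, hg, hg1⟩ := Finset.extract_gcd v (s := Finset.univ) ⟨i₀, Finset.mem_univ _⟩
  set G := Finset.univ.gcd v
  have hG : G ≠ 0 := fun h0 => hi₀ (by simpa [h0] using hg i₀ (Finset.mem_univ _))
  -- The sign of the gcd is moved into the primitive vector so that the multiplier is a natural
  -- number.
  refine ⟨G.natAbs, fun i => G.sign * g i, Int.natAbs_pos.2 hG, fun k hk => ?_, ?_⟩
  · have : k ∣ Finset.univ.gcd g := Finset.dvd_gcd fun i _ => by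
      have h1 : G.sign * (G.sign * g i) = g i := by
        rw [← mul_assoc, ← Int.sign_mul, Int.sign_eq_one_of_pos (mul_self_pos.2 hG), one_mul]
      rw [← h1]
      exact (hk i).mul_left _
    rw [hg1] at this
    exact isUnit_of_dvd_one this
  · ext i
    rw [hg i (Finset.mem_univ _)]
    simp only [Pi.smul_apply, nsmul_eq_mul, ← mul_assoc]
    rw [Int.natCast_natAbs, mul_comm |G|, Int.sign_mul_abs]

/-- For `n` independent vectors the order is the absolute value of the determinant. -/
theorem quotOrder_range {u : Fin n → Fin n → ℤ} (hu : LinearIndependent ℤ u) :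
    quotOrder (Set.range u) = (Matrix.of u).det.natAbs := by
  -- `n` independent vectors span `ℝⁿ`, so the local group is `ℤⁿ` modulo a full-rank sublattice,
  -- whose index is a determinant.
  have hsat : saturation (Set.range u) = ⊤ := by
    rw [eq_top_iff]
    rintro v -
    have hR : LinearIndependent ℝ (fun i => algebraMap ℤ ℝ ∘ u i) :=
      linearIndependent_algebraMap_comp_iff.2 hu
    have := hR.span_eq_top_of_card_eq_finrank' (by simp)
    change intCast n v ∈ Submodule.span ℝ (intCast n '' Set.range u)
    rw [← Set.range_comp]
    exact this.ge trivial
  let e : saturation (Set.range u) ≃ₗ[ℤ] (Fin n → ℤ) := LinearEquiv.ofTop _ hsat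
  have hcard : quotOrder (Set.range u) =
      Nat.card ((Fin n → ℤ) ⧸ Submodule.span ℤ (Set.range u)) := by
    refine Nat.card_congr (Submodule.Quotient.equiv _ _ e ?_).toEquiv
    ext x
    simp only [Submodule.mem_map, Submodule.mem_comap]
    constructor
    · rintro ⟨y, hy, rfl⟩
      exact hy
    · intro hx
      exact ⟨e.symm x, hx, e.apply_symm_apply x⟩
  rw [hcard, ← Submodule.natAbs_det_basis_change (Pi.basisFun ℤ (Fin n)) _ (Module.Basis.span hu),
    Pi.basisFun_det]
  congr 2
  ext i : 1
  exact congrArg Subtype.val (Module.Basis.span_apply hu i)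

theorem det_ne_zero_of_linearIndependent {u : Fin n → Fin n → ℤ} (hu : LinearIndependent ℤ u) :
    (Matrix.of u).det ≠ 0 := by
  intro h0
  obtain ⟨c, hc, hc0⟩ := Matrix.exists_vecMul_eq_zero_iff.2 h0
  apply hc
  rw [Matrix.vecMul_eq_sum] at hc0
  ext i
  exact Fintype.linearIndependent_iff.1 hu c hc0 i

theorem linearIndependent_of_det {u : Fin n → Fin n → ℤ} (hu : (Matrix.of u).det ≠ 0) :
    LinearIndependent ℤ u := by
  rw [Fintype.linearIndependent_iff]
  intro c hc
  by_contra hcon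
  push Not at hcon
  refine hu (Matrix.exists_vecMul_eq_zero_iff.1 ⟨c, ?_, ?_⟩)
  · rintro rfl
    simp at hcon
  · rw [Matrix.vecMul_eq_sum]
    exact hc

/-- Replacing one of `n` vectors by a rational combination multiplies the determinant by the
corresponding coefficient. -/
theorem det_update_of_rat (u : Fin n → Fin n → ℤ) (w : Fin n → ℤ) (r : Fin n → ℚ)
    (hw : ∀ a, (w a : ℚ) = ∑ i, r i * (u i a : ℚ)) (j : Fin n) :
    ((Matrix.of (Function.update u j w)).det : ℚ) = r j * ((Matrix.of u).det : ℚ) := by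
  have h1 := Matrix.det_updateRow_sum ((Matrix.of u).map (Int.castRingHom ℚ)) j r
  rw [smul_eq_mul] at h1
  have h2 : ((Matrix.of u).det : ℚ) = ((Matrix.of u).map (Int.castRingHom ℚ)).det := by
    exact (Int.castRingHom ℚ).map_det _
  have h3 : ((Matrix.of (Function.update u j w)).det : ℚ) =
      ((Matrix.of (Function.update u j w)).map (Int.castRingHom ℚ)).det := by
    exact (Int.castRingHom ℚ).map_det _
  rw [h2, h3, ← h1]
  congr 1
  ext i a
  by_cases hi : i = j
  · subst hi
    simp [hw]
  · simp [hi, Matrix.updateRow_apply]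

end

/-! ### Blowups: the cut polytope, the exchanged vector, and descent of the orders. -/

section

variable {n : ℕ} {ι : Type}

/-! ### Cutting off a face -/

/-- The functionals `a`, together with `l`. -/
def cutFun (a : ι → (Fin n → ℝ) →ₗ[ℝ] ℝ) (l : (Fin n → ℝ) →ₗ[ℝ] ℝ) :
    Option ι → (Fin n → ℝ) →ₗ[ℝ] ℝ
  | none => l
  | some i => a i

/-- The bounds `b`, together with `c`. -/
def cutBound (b : ι → ℝ) (c : ℝ) : Option ι → ℝ
  | none => c
  | some i => b i

theorem some_mem_tightSet_cut {a : ι → (Fin n → ℝ) →ₗ[ℝ] ℝ} {b : ι → ℝ}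
    {l : (Fin n → ℝ) →ₗ[ℝ] ℝ} {c : ℝ} {x : Fin n → ℝ} {i : ι} :
    some i ∈ tightSet (cutFun a l) (cutBound b c) x ↔ i ∈ tightSet a b x := Iff.rfl

theorem none_mem_tightSet_cut {a : ι → (Fin n → ℝ) →ₗ[ℝ] ℝ} {b : ι → ℝ}
    {l : (Fin n → ℝ) →ₗ[ℝ] ℝ} {c : ℝ} {x : Fin n → ℝ} :
    none ∈ tightSet (cutFun a l) (cutBound b c) x ↔ l x = c := Iff.rfl

theorem tightSet_cut_of_ne {a : ι → (Fin n → ℝ) →ₗ[ℝ] ℝ} {b : ι → ℝ}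
    {l : (Fin n → ℝ) →ₗ[ℝ] ℝ} {c : ℝ} {x : Fin n → ℝ} (hx : l x ≠ c) :
    tightSet (cutFun a l) (cutBound b c) x = some '' tightSet a b x := by
  ext i
  cases i with
  | none => simp [none_mem_tightSet_cut, hx]
  | some i => simp [some_mem_tightSet_cut]

theorem tightSet_cut_of_eq {a : ι → (Fin n → ℝ) →ₗ[ℝ] ℝ} {b : ι → ℝ}
    {l : (Fin n → ℝ) →ₗ[ℝ] ℝ} {c : ℝ} {x : Fin n → ℝ} (hx : l x = c) :
    tightSet (cutFun a l) (cutBound b c) x = insert none (some '' tightSet a b x) := by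
  ext i
  cases i with
  | none => simp [none_mem_tightSet_cut, hx]
  | some i => simp [some_mem_tightSet_cut]

/-- The hyperplane `l = c` strictly separates the vertices of the face `faceOf P a b J` from the
other vertices of `P`. -/
structure IsCut (P : Set (Fin n → ℝ)) (a : ι → (Fin n → ℝ) →ₗ[ℝ] ℝ) (b : ι → ℝ) (J : Set ι)
    (l : (Fin n → ℝ) →ₗ[ℝ] ℝ) (c : ℝ) : Prop where
  nonempty : (faceOf P a b J).Nonempty
  -- Codimension at least two: then no single facet is contained in the face cut off, and every old
  -- inequality stays tight somewhere.
  nontrivial : J.Nontrivial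
  pos : ∀ v ∈ vertices P, v ∈ faceOf P a b J → c < l v
  neg : ∀ v ∈ vertices P, v ∉ faceOf P a b J → l v < c

section cut

variable {P : Set (Fin n → ℝ)} {a : ι → (Fin n → ℝ) →ₗ[ℝ] ℝ} {b : ι → ℝ} {J : Set ι}
  {l : (Fin n → ℝ) →ₗ[ℝ] ℝ} {c : ℝ}

theorem IsHRep.exists_eq_between (h : IsHRep P a b) {x y : Fin n → ℝ} (hx : x ∈ P) (hy : y ∈ P)
    (hlx : l x < c) (hly : c < l y) :
    ∃ z ∈ P, l z = c ∧ ∀ i ∈ tightSet a b x, i ∈ tightSet a b y → i ∈ tightSet a b z := by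
  have h0 : 0 < l y - l x := by linarith
  set t := (c - l x) / (l y - l x) with ht
  have ht' : t * (l y - l x) = c - l x := div_mul_cancel₀ _ h0.ne'
  have ht0 : 0 ≤ t := div_nonneg (by linarith) h0.le
  have ht1 : t ≤ 1 := (div_le_one h0).2 (by linarith)
  refine ⟨(1 - t) • x + t • y, h.convex hx hy (by linarith) ht0 (by ring), ?_, ?_⟩
  · simp only [map_add, map_smul, smul_eq_mul]
    linarith
  · intro i hi hi'
    rw [mem_tightSet] at *
    simp only [map_add, map_smul, smul_eq_mul, hi, hi']
    ring

theorem IsSimpleHRep.ncard_tightSet_le (h : IsSimpleHRep P a b) {x : Fin n → ℝ} (hx : x ∈ P) :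
    (tightSet a b x).ncard ≤ n := by
  have := h.finite
  have := Fintype.ofFinite (tightSet a b x)
  have h1 := (h.indep x hx).linearIndependent.fintype_card_le_finrank
  rwa [← Nat.card_eq_fintype_card, Nat.card_coe_set_eq, Subspace.dual_finrank_eq,
    Module.finrank_fin_fun] at h1

/-- For `j ∈ J \ K` the inequality `j` is slack at a generic point of the `K`-face, hence slack at a
vertex of that face minimizing `a j`. -/
theorem IsSimpleHRep.exists_vertex_notMem (h : IsSimpleHRep P a b) {K : Set ι}
    (hK : (faceOf P a b K).Nonempty) (hJK : ¬ J ⊆ K) :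
    ∃ v ∈ vertices P, v ∈ faceOf P a b K ∧ v ∉ faceOf P a b J := by
  obtain ⟨j, hj, hjK⟩ := Set.not_subset.1 hJK
  obtain ⟨v, hv, hvK, hmax⟩ := h.exists_vertex_max (h.isFace_faceOf hK) (-a j)
  refine ⟨v, hv, hvK, fun hvJ => hjK ?_⟩
  obtain ⟨x, hx⟩ := hK
  obtain ⟨z, hz, hzt⟩ := h.exists_tightSet_eq hx.1 hx.2
  have h1 := hmax z ⟨hz, hzt.ge⟩
  have h2 : a j v = b j := hvJ.2 hj
  have h3 := (h.mem_iff z).1 hz j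
  rw [← hzt, mem_tightSet]
  simp only [LinearMap.neg_apply, neg_le_neg_iff] at h1
  linarith

namespace IsCut

theorem pos_of_mem_face (hc : IsCut P a b J l c) (h : IsSimpleHRep P a b) {x : Fin n → ℝ}
    (hx : x ∈ faceOf P a b J) : c < l x := by
  obtain ⟨v, hv, hvJ, hmax⟩ := h.exists_vertex_max (h.isFace_faceOf ⟨x, hx⟩) (-l)
  have h1 := hmax x hx
  have h2 := hc.pos v hv hvJ
  simp only [LinearMap.neg_apply, neg_le_neg_iff] at h1
  linarith

theorem vertex_ne (hc : IsCut P a b J l c) {v : Fin n → ℝ} (hv : v ∈ vertices P) : l v ≠ c := by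
  by_cases hvJ : v ∈ faceOf P a b J
  · exact (hc.pos v hv hvJ).ne'
  · exact (hc.neg v hv hvJ).ne

theorem mem_face_of_le (hc : IsCut P a b J l c) {v : Fin n → ℝ} (hv : v ∈ vertices P)
    (hl : c ≤ l v) : v ∈ faceOf P a b J := by
  by_contra hvJ
  exact (hc.neg v hv hvJ).not_ge hl

/-- If `l` were a combination of the normals tight at `x`, it would be constant on the face they
define. That face has a vertex, and no vertex of `P` lies on the hyperplane. -/
theorem notMem_span (hc : IsCut P a b J l c) (h : IsSimpleHRep P a b) {x : Fin n → ℝ}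
    (hx : x ∈ P) (hlx : l x = c) : l ∉ Submodule.span ℝ (a '' tightSet a b x) := by
  intro hl
  obtain ⟨v, hv, hvx, -⟩ := h.exists_vertex_max
    (h.isFace_faceOf (J := tightSet a b x) ⟨x, hx, subset_rfl⟩) 0
  refine hc.vertex_ne hv (Eq.trans ?_ hlx)
  refine Submodule.span_induction (p := fun g _ => g v = g x) ?_ rfl ?_ ?_ hl
  · rintro _ ⟨i, hi, rfl⟩
    have h1 : a i v = b i := hvx.2 hi
    exact h1.trans hi.symm
  · intro g g' _ _ hg hg'
    simp [hg, hg']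
  · intro r g _ hg
    simp [hg]

/-- Cutting a face off a simple polytope gives a simple polytope. -/
theorem isSimpleHRep (hc : IsCut P a b J l c) (h : IsSimpleHRep P a b) :
    IsSimpleHRep (P ∩ {x | l x ≤ c}) (cutFun a l) (cutBound b c) where
  finite := by
    have := h.finite
    infer_instance
  mem_iff x := by
    rw [Option.forall]
    change x ∈ P ∧ l x ≤ c ↔ l x ≤ c ∧ ∀ i, a i x ≤ b i
    rw [h.mem_iff, and_comm]
  bounded := h.bounded.subset Set.inter_subset_left
  nonempty := by
    obtain ⟨x, hx⟩ := hc.nonempty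
    obtain ⟨v, hv, -, hvJ⟩ := h.exists_vertex_notMem (J := J) (K := ∅)
      ⟨x, hx.1, Set.empty_subset _⟩ (fun hs => hc.nontrivial.nonempty.ne_empty
        (Set.subset_empty_iff.1 hs))
    exact ⟨v, hv.1.subset rfl, (hc.neg v hv hvJ).le⟩
  indep x hx := by
    have hsome : LinearIndepOn ℝ (cutFun a l) (some '' tightSet a b x) :=
      LinearIndepOn.image_of_comp some (cutFun a l) (h.indep x hx.1)
    by_cases hlx : l x = c
    · rw [tightSet_cut_of_eq hlx]
      refine hsome.insert ?_
      rw [Set.image_image]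
      exact hc.notMem_span h hx.1 hlx
    · rw [tightSet_cut_of_ne hlx]
      exact hsome
  exists_tight i := by
    cases i with
    | none =>
      obtain ⟨x, hx⟩ := hc.nonempty
      obtain ⟨v, hv, -, hvJ⟩ := h.exists_vertex_notMem (J := J) (K := ∅)
        ⟨x, hx.1, Set.empty_subset _⟩ (fun hs => hc.nontrivial.nonempty.ne_empty
          (Set.subset_empty_iff.1 hs))
      obtain ⟨z, hz, hlz, -⟩ := h.exists_eq_between (hv.1.subset rfl) hx.1 (hc.neg v hv hvJ)
        (hc.pos_of_mem_face h hx)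
      exact ⟨z, ⟨hz, hlz.le⟩, hlz⟩
    | some i =>
      obtain ⟨v, hv, hvi, hvJ⟩ := h.exists_vertex_notMem (J := J) (h.isFacet i).1.2
        (fun hs => hc.nontrivial.not_subset_singleton hs)
      exact ⟨v, ⟨hv.1.subset rfl, (hc.neg v hv hvJ).le⟩, hvi.2 rfl⟩

/-- The vertices off the new facet are the vertices off the face. -/
theorem vertices_diff (hc : IsCut P a b J l c) (h : IsSimpleHRep P a b) {v : Fin n → ℝ} :
    v ∈ vertices (P ∩ {x | l x ≤ c}) ∧ l v ≠ c ↔ v ∈ vertices P ∧ v ∉ faceOf P a b J := by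
  rw [(hc.isSimpleHRep h).mem_vertices_iff_ncard, h.mem_vertices_iff_ncard]
  constructor
  · rintro ⟨⟨hvP, hn⟩, hne⟩
    rw [tightSet_cut_of_ne hne, Set.ncard_image_of_injective _ (Option.some_injective _)] at hn
    exact ⟨⟨hvP.1, hn⟩, fun hvJ => hvP.2.not_gt (hc.pos_of_mem_face h hvJ)⟩
  · rintro ⟨hv, hvJ⟩
    have hlt := hc.neg v (h.mem_vertices_iff_ncard.2 hv) hvJ
    refine ⟨⟨⟨hv.1, hlt.le⟩, ?_⟩, hlt.ne⟩
    rw [tightSet_cut_of_ne hlt.ne, Set.ncard_image_of_injective _ (Option.some_injective _)]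
    exact hv.2

theorem mem_vertices_cut_iff (hc : IsCut P a b J l c) (h : IsSimpleHRep P a b) {w : Fin n → ℝ}
    (hlw : l w = c) : w ∈ vertices (P ∩ {x | l x ≤ c}) ↔ w ∈ P ∧ (tightSet a b w).ncard + 1 = n := by
  have := h.finite
  rw [(hc.isSimpleHRep h).mem_vertices_iff_ncard, tightSet_cut_of_eq hlw,
    Set.ncard_insert_of_notMem (by simp) (Set.toFinite _),
    Set.ncard_image_of_injective _ (Option.some_injective _)]
  exact and_congr_left fun _ => ⟨fun hw => hw.1, fun hw => ⟨hw, hlw.le⟩⟩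

/-- A new vertex over the vertex `v` lies on all facets through `v` but one, which contains the
face that is cut off. -/
theorem exists_tightSet_eq_diff (hc : IsCut P a b J l c) (h : IsSimpleHRep P a b)
    {v w : Fin n → ℝ} (hv : v ∈ vertices P) (hvJ : v ∈ faceOf P a b J)
    (hw : w ∈ vertices (P ∩ {x | l x ≤ c})) (hlw : l w = c)
    (hwv : tightSet a b w ⊆ tightSet a b v) :
    ∃ j ∈ J, tightSet a b w = tightSet a b v \ {j} := by
  have := h.finite
  obtain ⟨hwP, hwn⟩ := (hc.mem_vertices_cut_iff h hlw).1 hw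
  have hvn := (h.mem_vertices_iff_ncard.1 hv).2
  have h1 : (tightSet a b v \ tightSet a b w).ncard = 1 := by
    rw [Set.ncard_sdiff hwv (Set.toFinite _)]
    omega
  obtain ⟨j, hj⟩ := Set.ncard_eq_one.1 h1
  have h2 : tightSet a b w = tightSet a b v \ {j} := by
    rw [← hj, Set.sdiff_sdiff_right_self, Set.inter_eq_right.2 hwv]
  refine ⟨j, ?_, h2⟩
  -- Otherwise `w` would still lie on all facets in `J`, thus on the face, where `l > c`.
  by_contra hjJ
  have h3 : w ∈ faceOf P a b J := ⟨hwP, fun i hi => by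
    rw [h2]
    exact ⟨hvJ.2 hi, fun hij => hjJ (hij ▸ hi)⟩⟩
  exact (hc.pos_of_mem_face h h3).ne' hlw

/-- The edge leaving `v` off the facet `j` reaches a vertex outside the face, so it crosses the
hyperplane. The crossing point keeps `n - 1` tight inequalities, and independence together with `l`
allows no more. -/
theorem exists_vertex_over (hc : IsCut P a b J l c) (h : IsSimpleHRep P a b)
    {v : Fin n → ℝ} (hv : v ∈ vertices P) (hvJ : v ∈ faceOf P a b J) {j : ι} (hj : j ∈ J) :
    ∃ w ∈ vertices (P ∩ {x | l x ≤ c}), l w = c ∧ tightSet a b w = tightSet a b v \ {j} := by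
  have := h.finite
  have hvP : v ∈ P := hv.1.subset rfl
  obtain ⟨v', hv', hvK, hvJ'⟩ := h.exists_vertex_notMem (J := J) (K := tightSet a b v \ {j})
    ⟨v, hvP, Set.sdiff_subset⟩ (fun hs => (hs hj).2 rfl)
  obtain ⟨w, hwP, hlw, hwt⟩ := h.exists_eq_between (hv'.1.subset rfl) hvP (hc.neg v' hv' hvJ')
    (hc.pos v hv hvJ)
  have hsub : tightSet a b v \ {j} ⊆ tightSet a b w := fun i hi => hwt i (hvK.2 hi) hi.1
  have hvn := (h.mem_vertices_iff_ncard.1 hv).2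
  have h1 : (tightSet a b v \ {j}).ncard + 1 = n := by
    rw [Set.ncard_sdiff_singleton_add_one (hvJ.2 hj) (Set.toFinite _), hvn]
  have h2 : (tightSet a b w).ncard + 1 ≤ n := by
    have h3 := (hc.isSimpleHRep h).ncard_tightSet_le (x := w) ⟨hwP, hlw.le⟩
    rwa [tightSet_cut_of_eq hlw, Set.ncard_insert_of_notMem (by simp) (Set.toFinite _),
      Set.ncard_image_of_injective _ (Option.some_injective _)] at h3
  have h3 : tightSet a b w = tightSet a b v \ {j} :=
    (Set.eq_of_subset_of_ncard_le hsub (by omega) (Set.toFinite _)).symm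
  exact ⟨w, (hc.mem_vertices_cut_iff h hlw).2 ⟨hwP, by rw [h3, h1]⟩, hlw, h3⟩

/-- Over every vertex of the face lie as many new vertices as there are facets containing the
face. -/
theorem ncard_vertices_over (hc : IsCut P a b J l c) (h : IsSimpleHRep P a b)
    {v : Fin n → ℝ} (hv : v ∈ vertices P) (hvJ : v ∈ faceOf P a b J) :
    {w | w ∈ vertices (P ∩ {x | l x ≤ c}) ∧ l w = c ∧ tightSet a b w ⊆ tightSet a b v}.ncard =
      J.ncard := by
  choose f hf hlf hft using fun j : J => hc.exists_vertex_over h hv hvJ j.2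
  symm
  refine Set.ncard_congr (fun j hj => f ⟨j, hj⟩)
    (fun j hj => ⟨hf _, hlf _, (hft ⟨j, hj⟩).le.trans Set.sdiff_subset⟩) ?_ ?_
  · intro i j hi hj hij
    have h1 := hft ⟨i, hi⟩
    rw [hij, hft ⟨j, hj⟩] at h1
    by_contra hne
    have : i ∈ tightSet a b v \ {j} := ⟨hvJ.2 hi, hne⟩
    rw [h1] at this
    exact this.2 rfl
  · rintro w ⟨hw, hlw, hwv⟩
    obtain ⟨j, hj, hjt⟩ := hc.exists_tightSet_eq_diff h hv hvJ hw hlw hwv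
    refine ⟨j, hj, (hc.isSimpleHRep h).tightSet_injOn_vertices (hf _) hw ?_⟩
    rw [tightSet_cut_of_eq hlw, tightSet_cut_of_eq (hlf _), hft, hjt]

/-- Every new vertex lies over exactly one vertex of the face. -/
theorem existsUnique_vertex_under (hc : IsCut P a b J l c) (h : IsSimpleHRep P a b)
    {w : Fin n → ℝ} (hw : w ∈ vertices (P ∩ {x | l x ≤ c})) (hlw : l w = c) :
    ∃! v, (v ∈ vertices P ∧ v ∈ faceOf P a b J) ∧ tightSet a b w ⊆ tightSet a b v := by
  have hwP := ((hc.mem_vertices_cut_iff h hlw).1 hw).1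
  have hwker := ((hc.isSimpleHRep h).mem_vertices_iff.1 hw).2
  -- The facets through `w` define an edge of `P`; the vertex sought is its end with the larger
  -- value of `l`.
  obtain ⟨v, hv, hvw, hmax⟩ := h.exists_vertex_max
    (h.isFace_faceOf (J := tightSet a b w) ⟨w, hwP, subset_rfl⟩) l
  have hlv : c ≤ l v := hlw ▸ hmax w ⟨hwP, subset_rfl⟩
  refine ⟨v, ⟨⟨hv, hc.mem_face_of_le hv hlv⟩, hvw.2⟩, ?_⟩
  rintro v' ⟨⟨hv', hvJ'⟩, hwv'⟩
  have hlv' := hc.pos v' hv' hvJ'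
  have hlv : c < l v := lt_of_le_of_ne hlv (hc.vertex_ne hv).symm
  -- `v - w` and `v' - w` are proportional
  have hprop : (l v' - c) • (v - w) = (l v - c) • (v' - w) := by
    rw [← sub_eq_zero]
    refine hwker _ ?_
    intro i hi
    cases i with
    | none =>
      change l _ = 0
      simp only [map_sub, map_smul, smul_eq_mul, hlw]
      ring
    | some i =>
      change a i _ = 0
      have h1 : a i w = b i := hi
      have h2 : a i v = b i := hvw.2 hi
      have h3 : a i v' = b i := hwv' hi
      simp [h1, h2, h3]
  have hvP : v ∈ P := hv.1.subset rfl
  have hle : l v' ≤ l v := hmax v' ⟨hv'.1.subset rfl, hwv'⟩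
  -- `v'` lies on the segment from `w` to `v`, hence is `v`
  have hker' := (h.mem_vertices_iff.1 hv').2
  refine (sub_eq_zero.1 (hker' (v - v') fun i hi => ?_)).symm
  have hi : a i v' = b i := hi
  have h1 := congrArg (a i) hprop
  simp only [map_sub, map_smul, smul_eq_mul, hi] at h1
  have h2 := (h.mem_iff v).1 hvP i
  have h3 := (h.mem_iff w).1 hwP i
  rw [map_sub, hi, sub_eq_zero]
  -- By `h1` the gap from `a i w` to `a i v` is the gap from `a i w` to `b i` times `(l v - c) / (l
  -- v' - c) ≥ 1`, so `a i v ≥ b i`.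
  nlinarith

end IsCut
end cut

end

section

variable {n : ℕ} {ι : Type}

/-! ### Exchanging a vector -/

theorem sum_eq_sum_subtype {κ M : Type*} [Fintype κ] [AddCommMonoid M] (T : Set κ) [Fintype T]
    {f : κ → M} (hf : ∀ i ∉ T, f i = 0) : ∑ i, f i = ∑ i : T, f i := by
  classical
  rw [← Finset.sum_subtype T.toFinset (fun i => Set.mem_toFinset) f]
  exact (Finset.sum_subset (Finset.subset_univ _) fun i _ hi => hf i (by simpa using hi)).symm

/-- Replacing one of `n` independent vectors by a rational combination of them multiplies the
order of the local group by the absolute value of the corresponding coefficient. -/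
theorem exchange_vector {κ : Type} [Fintype κ] {lam : κ → Fin n → ℤ} {T : Set κ}
    (hT : T.ncard = n) (hind : LinearIndepOn ℤ lam T) {w : Fin n → ℤ} {r : κ → ℚ}
    (hr : ∀ i ∉ T, r i = 0) (hw : ∀ a, (w a : ℚ) = ∑ i, r i * (lam i a : ℚ)) {j : κ} (hj : j ∈ T)
    (hrj : r j ≠ 0) :
    LinearIndepOn ℤ (fun o : Option κ => o.elim w lam) (insert none (some '' (T \ {j}))) ∧
      (quotOrder ((fun o : Option κ => o.elim w lam) '' insert none (some '' (T \ {j}))) : ℚ) =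
        |r j| * quotOrder (lam '' T) ∧ 0 < quotOrder (lam '' T) := by
  classical
  set μ : Option κ → Fin n → ℤ := fun o => o.elim w lam with hμ
  obtain ⟨σ⟩ : Nonempty (Fin n ≃ T) := by
    rw [← Fintype.card_eq, Fintype.card_fin, ← Nat.card_eq_fintype_card, Nat.card_coe_set_eq, hT]
  set j₀ := σ.symm ⟨j, hj⟩ with hj₀
  let u : Fin n → Fin n → ℤ := fun i => lam (σ i)
  have hu : LinearIndependent ℤ u := hind.linearIndependent.comp σ σ.injective
  have hurange : Set.range u = lam '' T := by
    ext x
    constructor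
    · rintro ⟨i, rfl⟩
      exact ⟨_, (σ i).2, rfl⟩
    · rintro ⟨i, hi, rfl⟩
      exact ⟨σ.symm ⟨i, hi⟩, by simp [u]⟩
  -- Numbering `T` by `Fin n` and putting the new index `none` in the slot of `j` turns the exchange
  -- into the replacement of one row of a determinant.
  let f : Fin n → Option κ := Function.update (fun i => some (σ i : κ)) j₀ none
  have hf : Function.Injective f := by
    intro i i' hii
    by_cases h1 : i = j₀ <;> by_cases h2 : i' = j₀
    · rw [h1, h2]
    · simp [f, h1, h2] at hii
    · simp [f, h1, h2] at hii
    · refine σ.injective (Subtype.ext ?_)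
      simpa [f, h1, h2] using hii
  have hfrange : Set.range f = insert none (some '' (T \ {j})) := by
    ext o
    constructor
    · rintro ⟨i, rfl⟩
      by_cases h1 : i = j₀
      · left
        simp [f, h1]
      · right
        refine ⟨σ i, ⟨(σ i).2, fun he => h1 ?_⟩, by simp [f, h1]⟩
        rw [hj₀, Equiv.eq_symm_apply]
        exact Subtype.ext he
    · rintro (rfl | ⟨i, ⟨hi, hij⟩, rfl⟩)
      · exact ⟨j₀, by simp [f]⟩
      · refine ⟨σ.symm ⟨i, hi⟩, ?_⟩
        have : σ.symm ⟨i, hi⟩ ≠ j₀ := fun he => hij (by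
          rw [hj₀, σ.symm.apply_eq_iff_eq] at he
          exact congrArg Subtype.val he)
        simp [f, this]
  have hμf : μ ∘ f = Function.update u j₀ w := by
    rw [Function.comp_update]
    rfl
  have hwu : ∀ a, (w a : ℚ) = ∑ i, r (σ i) * (u i a : ℚ) := by
    intro a
    rw [hw a, sum_eq_sum_subtype T (fun i hi => by rw [hr i hi, zero_mul])]
    exact (σ.sum_comp (fun i : T => r i * (lam i a : ℚ))).symm
  have hdet := det_update_of_rat u w (fun i => r (σ i)) hwu j₀
  have hrj₀ : r (σ j₀) = r j := by simp [hj₀]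
  rw [hrj₀] at hdet
  have hdu := det_ne_zero_of_linearIndependent hu
  have hind' : LinearIndependent ℤ (Function.update u j₀ w) := by
    apply linearIndependent_of_det
    intro h0
    rw [h0, Int.cast_zero] at hdet
    exact mul_ne_zero hrj (Int.cast_ne_zero.2 hdu) hdet.symm
  refine ⟨?_, ?_, ?_⟩
  · rw [← hfrange, linearIndepOn_range_iff hf, hμf]
    exact hind'
  · rw [← hfrange, ← Set.range_comp, hμf, ← hurange, quotOrder_range hind', quotOrder_range hu,
      Nat.cast_natAbs, Nat.cast_natAbs, Int.cast_abs, Int.cast_abs, hdet, abs_mul]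
  · rw [← hurange, quotOrder_range hu]
    exact Int.natAbs_pos.2 hdu

/-- The denominator of `q` divides every entry of `u`. For primitive `u` it is `1`, but no integer
lies strictly between `0` and `1`. This rules out facets as maximal singular faces. -/
theorem not_isPrimitiveVec_of_fract {u v : Fin n → ℤ} {q : ℚ} (h0 : 0 < q) (h1 : q < 1)
    (hv : ∀ a, (v a : ℚ) = q * (u a : ℚ)) : ¬ IsPrimitiveVec u := by
  intro hu
  have hd : IsUnit (q.den : ℤ) := by
    refine hu _ fun a => ?_
    have h2 : q.num * u a = q.den * v a := by
      have h3 : (q.num : ℚ) * u a = q.den * v a := by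
        rw [hv a, ← mul_assoc, Rat.den_mul_eq_num]
      exact_mod_cast h3
    exact (Int.isCoprime_iff_gcd_eq_one.2
      (by simpa [Int.gcd, Nat.Coprime] using q.reduced.symm)).dvd_of_dvd_mul_left ⟨_, h2⟩
  have hd1 : q.den = 1 := by
    have := Int.isUnit_iff_natAbs_eq.1 hd
    simpa using this
  have hq : (q.num : ℚ) = q := by
    rw [← Rat.den_mul_eq_num, hd1]
    simp
  rw [← hq] at h0 h1
  have h2 : 0 < q.num := by exact_mod_cast h0
  have h3 : q.num < 1 := by exact_mod_cast h1
  omega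

/-! ### Characteristic pairs given by inequalities -/

namespace RCharPair

/-- The pair given by a presentation of a simple polytope and vectors for the inequalities. -/
def ofHRep {P : Set (Fin n → ℝ)} {a : ι → (Fin n → ℝ) →ₗ[ℝ] ℝ} {b : ι → ℝ}
    (h : IsSimpleHRep P a b) (μ : ι → Fin n → ℤ) (hprim : ∀ i, IsPrimitiveVec (μ i))
    (hind : ∀ x ∈ P, LinearIndepOn ℤ μ (tightSet a b x)) : RCharPair n where
  poly := P
  isSimple := h.isSimplePolytope
  lam F := μ (h.facetEquiv.symm F)
  primitive F := hprim _
  indep S hS := by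
    -- The empty family is treated apart: its intersection is the whole space, so a point of it need
    -- not lie in `P`.
    rcases S.eq_empty_or_nonempty with rfl | ⟨F₀, hF₀⟩
    · exact linearIndependent_empty_type
    obtain ⟨x, hx⟩ := hS
    have hx : ∀ F ∈ S, x ∈ F.1 := fun F hF => Set.mem_iInter₂.1 hx F hF
    have hmem : ∀ F ∈ S, x ∈ P ∧ h.facetEquiv.symm F ∈ tightSet a b x := fun F hF => by
      rw [← h.mem_facetEquiv, Equiv.apply_symm_apply]
      exact hx F hF
    exact (hind x (hmem F₀ hF₀).1).linearIndependent.comp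
      (fun F : S => ⟨h.facetEquiv.symm F.1, (hmem F.1 F.2).2⟩) fun F G hFG =>
        Subtype.ext (h.facetEquiv.symm.injective (congrArg Subtype.val hFG))

theorem ofHRep_vecs {P : Set (Fin n → ℝ)} {a : ι → (Fin n → ℝ) →ₗ[ℝ] ℝ} {b : ι → ℝ}
    (h : IsSimpleHRep P a b) (μ : ι → Fin n → ℤ) (hprim : ∀ i, IsPrimitiveVec (μ i))
    (hind : ∀ x ∈ P, LinearIndepOn ℤ μ (tightSet a b x)) {x : Fin n → ℝ} (hx : x ∈ P) :
    (ofHRep h μ hprim hind).vecs {x} = μ '' tightSet a b x := by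
  ext u
  constructor
  · rintro ⟨G, hG, rfl⟩
    refine ⟨h.facetEquiv.symm G, ?_, rfl⟩
    have hxG : x ∈ G.1 := hG rfl
    rw [← h.facetEquiv.apply_symm_apply G, h.mem_facetEquiv] at hxG
    exact hxG.2
  · rintro ⟨i, hi, rfl⟩
    refine ⟨h.facetEquiv i, ?_, ?_⟩
    · rintro _ rfl
      exact h.mem_facetEquiv.2 ⟨hx, hi⟩
    · change μ (h.facetEquiv.symm (h.facetEquiv i)) = μ i
      rw [Equiv.symm_apply_apply]

/-- A presentation of the polytope of a pair by inequalities indexed by the facets. -/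
structure IsPresentation (A : RCharPair n) (a : A.Facet → (Fin n → ℝ) →ₗ[ℝ] ℝ)
    (b : A.Facet → ℝ) : Prop extends IsSimpleHRep A.poly a b where
  mem_facet : ∀ G x, x ∈ G.1 ↔ x ∈ A.poly ∧ G ∈ tightSet a b x

theorem exists_isPresentation (hn : 1 ≤ n) (A : RCharPair n) :
    ∃ a b, A.IsPresentation a b := by
  obtain ⟨a, b, h, hm⟩ := A.isSimple.exists_isSimpleHRep hn
  exact ⟨a, b, ⟨h, hm⟩⟩

namespace IsPresentation

variable {A : RCharPair n} {a : A.Facet → (Fin n → ℝ) →ₗ[ℝ] ℝ} {b : A.Facet → ℝ}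

theorem facet_eq (h : A.IsPresentation a b) (G : A.Facet) : G.1 = faceOf A.poly a b {G} := by
  ext x
  rw [h.mem_facet]
  simp [faceOf]

theorem linearIndepOn (h : A.IsPresentation a b) {x : Fin n → ℝ} (hx : x ∈ A.poly) :
    LinearIndepOn ℤ A.lam (tightSet a b x) :=
  A.indep (tightSet a b x) ⟨x, Set.mem_iInter₂.2 fun G hG => (h.mem_facet G x).2 ⟨hx, hG⟩⟩

theorem vecs_singleton (h : A.IsPresentation a b) {x : Fin n → ℝ} (hx : x ∈ A.poly) :
    A.vecs {x} = A.lam '' tightSet a b x := by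
  rw [vecs]
  congr 1
  ext G
  change {x} ⊆ G.1 ↔ _
  rw [Set.singleton_subset_iff, h.mem_facet]
  exact and_iff_right hx

theorem setOf_faceOf_subset (h : A.IsPresentation a b) {K : Set A.Facet}
    (hK : (faceOf A.poly a b K).Nonempty) : {G : A.Facet | faceOf A.poly a b K ⊆ G.1} = K := by
  ext G
  change _ ⊆ G.1 ↔ _
  rw [h.facet_eq G, h.faceOf_subset_faceOf_iff hK, Set.singleton_subset_iff]

theorem eq_faceOf_setOf (h : A.IsPresentation a b) {F : Set (Fin n → ℝ)}
    (hF : IsFace A.poly F) : F = faceOf A.poly a b {G | F ⊆ G.1} := by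
  have h1 := h.eq_faceOf hF
  have hne := hF.2
  rw [h1] at hne
  have h2 := h.setOf_faceOf_subset hne
  rw [← h1] at h2
  rw [h2]
  exact h1

theorem vecs_faceOf (h : A.IsPresentation a b) {K : Set A.Facet}
    (hK : (faceOf A.poly a b K).Nonempty) : A.vecs (faceOf A.poly a b K) = A.lam '' K := by
  rw [vecs, h.setOf_faceOf_subset hK]

end IsPresentation

theorem singOrder_eq (A : RCharPair n) (F : Set (Fin n → ℝ)) :
    A.singOrder F = quotOrder (A.vecs F) := rfl

end RCharPair

end

section

variable {n : ℕ}

/-! ### One step of the resolution -/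

/-- The supporting functional of `F`, with a threshold just below its maximum; the finitely many
other vertices leave room for it. -/
theorem IsHRep.exists_separating {ι : Type} {P F : Set (Fin n → ℝ)}
    {a : ι → (Fin n → ℝ) →ₗ[ℝ] ℝ} {b : ι → ℝ} (h : IsHRep P a b) (hF : IsFace P F) :
    ∃ (l : (Fin n → ℝ) →L[ℝ] ℝ) (c : ℝ), (∀ v ∈ vertices P, v ∈ F → c < l v) ∧
      ∀ v ∈ vertices P, v ∉ F → l v < c := by
  obtain ⟨l, hl⟩ := hF.1 hF.2
  obtain ⟨x, hx⟩ := hF.2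
  have hxP := hF.1.subset hx
  have hxmax : ∀ y ∈ P, l y ≤ l x := by
    rw [hl] at hx
    exact hx.2
  have hlt : ∀ v ∈ vertices P, v ∉ F → l v < l x := fun v hv hvF => by
    have hvP : v ∈ P := hv.1.subset rfl
    refine lt_of_le_of_ne (hxmax v hvP) fun he => hvF ?_
    rw [hl]
    exact ⟨hvP, fun y hy => he ▸ hxmax y hy⟩
  have hev : ∀ᶠ c in 𝓝[<] (l x), ∀ v ∈ vertices P, v ∉ F → l v < c := by
    rw [Filter.eventually_all_finite h.finite_vertices]
    intro v hv
    by_cases hvF : v ∈ F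
    · exact Filter.Eventually.of_forall fun c hc => absurd hvF hc
    · exact nhdsWithin_le_nhds ((lt_mem_nhds (hlt v hv hvF)).mono fun c hc _ => hc)
  obtain ⟨c, hc, hcx⟩ := (hev.and self_mem_nhdsWithin).exists
  refine ⟨l, c, fun v _ hvF => ?_, hc⟩
  have h1 : l x ≤ l v := by
    rw [hl] at hvF
    exact hvF.2 x hxP
  exact lt_of_lt_of_le hcx h1

namespace RCharPair

variable {A : RCharPair n} {a : A.Facet → (Fin n → ℝ) →ₗ[ℝ] ℝ} {b : A.Facet → ℝ}

/-- The lattice point used to blow up a maximal singular face. -/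
theorem IsPresentation.exists_lattice_point (h : A.IsPresentation a b) {F : Set (Fin n → ℝ)}
    (hF : A.IsMaximalSingular F) [Fintype {G : A.Facet | F ⊆ G.1}] :
    ∃ (q : {G : A.Facet | F ⊆ G.1} → ℚ) (v : Fin n → ℤ), (∀ j, 0 < q j ∧ q j < 1) ∧ v ≠ 0 ∧
      ∀ s, (v s : ℚ) = ∑ j, q j * (A.lam j.1 s : ℚ) := by
  obtain ⟨⟨hface, hsing⟩, hmax⟩ := hF
  have hFJ := h.eq_faceOf_setOf hface
  obtain ⟨x, hx⟩ := hface.2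
  have hxP := hface.1.subset hx
  have hJx : {G : A.Facet | F ⊆ G.1} ⊆ tightSet a b x := fun G hG => ((h.mem_facet G x).1 (hG hx)).2
  refine exists_fract_point (u := fun j : {G : A.Facet | F ⊆ G.1} => A.lam j.1)
    ((h.linearIndepOn hxP).mono hJx).linearIndependent ?_ ?_
  · intro hle
    apply hsing
    rw [singOrder_eq, quotOrder_eq_one_iff, vecs, Set.image_eq_range]
    exact hle
  · intro J' hJ'
    set K : Set A.Facet := Subtype.val '' J' with hK
    have hKJ : K ⊆ {G : A.Facet | F ⊆ G.1} := by
      rintro _ ⟨j, -, rfl⟩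
      exact j.2
    have hne : (faceOf A.poly a b K).Nonempty := ⟨x, hxP, hKJ.trans hJx⟩
    have hFK : F ⊆ faceOf A.poly a b K := by
      conv_lhs => rw [hFJ]
      exact faceOf_anti hKJ
    have himg : (fun j : {G : A.Facet | F ⊆ G.1} => A.lam j.1) '' J' = A.lam '' K := by
      rw [hK, Set.image_image]
    -- Dropping a facet strictly enlarges the face, and by maximality of `F` the larger face is not
    -- singular.
    rw [himg, ← quotOrder_eq_one_iff, ← h.vecs_faceOf hne, ← singOrder_eq]
    by_contra hcon
    have h1 := hmax ⟨h.isFace_faceOf hne, hcon⟩ hFK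
    rw [hFJ] at h1
    have h2 := (h.faceOf_subset_faceOf_iff hne).1 h1
    apply hJ'
    rw [Set.eq_univ_iff_forall]
    intro j
    obtain ⟨j', hj', he⟩ := h2 j.2
    rwa [← Subtype.ext he]

/-- A maximal singular face can be blown up. -/
theorem exists_isResolutionStep (hn : 1 ≤ n) (A : RCharPair n) {F : Set (Fin n → ℝ)}
    (hF : A.IsMaximalSingular F) : ∃ B, A.IsResolutionStep B := by
  classical
  obtain ⟨a, b, h⟩ := A.exists_isPresentation hn
  have hfin := h.finite
  have := Fintype.ofFinite A.Facet
  set J : Set A.Facet := {G : A.Facet | F ⊆ G.1} with hJ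
  obtain ⟨q, v, hq, hv0, hvq⟩ := h.exists_lattice_point hF
  obtain ⟨m, w, hm, hwprim, hvw⟩ := exists_primitive hv0
  have hface := hF.1.1
  have hFJ : F = faceOf A.poly a b J := h.eq_faceOf_setOf hface
  -- With no facet through `F` the lattice point would be an empty sum; with just one it would be a
  -- proper fraction of a primitive vector.
  have hnontriv : J.Nontrivial := by
    by_contra hcon
    rw [Set.not_nontrivial_iff] at hcon
    rcases J.eq_empty_or_nonempty with hem | ⟨G, hG⟩
    · apply hv0
      ext s
      have h1 := hvq s
      have hE : IsEmpty {G : A.Facet | F ⊆ G.1} := Set.isEmpty_coe_sort.2 hem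
      rw [Finset.univ_eq_empty, Finset.sum_empty] at h1
      exact_mod_cast h1
    · refine not_isPrimitiveVec_of_fract (hq ⟨G, hG⟩).1 (hq ⟨G, hG⟩).2 (v := v) (fun s => ?_)
        (A.primitive G)
      rw [hvq s]
      refine Fintype.sum_eq_single (⟨G, hG⟩ : {G : A.Facet | F ⊆ G.1}) fun j hj => ?_
      exact absurd (Subtype.ext (hcon j.2 hG)) hj
  obtain ⟨l, c, hpos, hneg⟩ := h.exists_separating hface
  have hc : IsCut A.poly a b J (l : (Fin n → ℝ) →ₗ[ℝ] ℝ) c :=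
    ⟨hFJ ▸ hface.2, hnontriv, fun v hv hvF => hpos v hv (hFJ ▸ hvF),
      fun v hv hvF => hneg v hv (hFJ ▸ hvF)⟩
  have hQ := hc.isSimpleHRep h.toIsSimpleHRep
  set Q := A.poly ∩ {x | (l : (Fin n → ℝ) →ₗ[ℝ] ℝ) x ≤ c} with hQdef
  let μ : Option A.Facet → Fin n → ℤ := fun o => o.elim w A.lam
  have hprim : ∀ o, IsPrimitiveVec (μ o)
    | none => hwprim
    | some G => A.primitive G
  -- Coefficients of `w = v / m`, extended by zero to all facets; dividing by `m ≥ 1` keeps them in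
  -- `(0, 1)` on `J`.
  let r : A.Facet → ℚ := fun G => if hG : G ∈ J then q ⟨G, hG⟩ / m else 0
  have hm' : (0 : ℚ) < m := by exact_mod_cast hm
  have hm1 : (1 : ℚ) ≤ m := by exact_mod_cast hm
  have hr : ∀ G ∈ J, 0 < r G ∧ r G < 1 := by
    intro G hG
    simp only [r, hG, dite_true]
    refine ⟨div_pos (hq _).1 hm', (div_lt_one hm').2 ((hq _).2.trans_le hm1)⟩
  have hwr : ∀ s, (w s : ℚ) = ∑ G, r G * (A.lam G s : ℚ) := by
    intro s
    have h1 : (v s : ℚ) = m * w s := by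
      rw [hvw]
      simp
    rw [hvq s] at h1
    rw [sum_eq_sum_subtype J (fun G hG => by simp [r, hG])]
    have h2 : ∀ G : J, r G * (A.lam G.1 s : ℚ) = (m : ℚ)⁻¹ * (q G * (A.lam G.1 s : ℚ)) := by
      rintro ⟨G, hG⟩
      simp only [r, hG, dite_true]
      ring
    rw [Finset.sum_congr rfl fun G _ => h2 G, ← Finset.mul_sum, eq_inv_mul_iff_mul_eq₀ hm'.ne',
      ← h1]
  -- the new vertices
  have hex : ∀ u ∈ vertices A.poly, u ∈ faceOf A.poly a b J → ∀ y ∈ vertices Q,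
      (l : (Fin n → ℝ) →ₗ[ℝ] ℝ) y = c → tightSet a b y ⊆ tightSet a b u →
      LinearIndepOn ℤ μ (tightSet (cutFun a (l : (Fin n → ℝ) →ₗ[ℝ] ℝ)) (cutBound b c) y) ∧
        quotOrder (μ '' tightSet (cutFun a (l : (Fin n → ℝ) →ₗ[ℝ] ℝ)) (cutBound b c) y) <
          quotOrder (A.lam '' tightSet a b u) := by
    intro u hu huJ y hy hly hyu
    obtain ⟨j, hj, hjt⟩ := hc.exists_tightSet_eq_diff h.toIsSimpleHRep hu huJ hy hly hyu
    obtain ⟨huP, hun⟩ := h.mem_vertices_iff_ncard.1 hu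
    obtain ⟨h1, h2, h3⟩ := exchange_vector hun (h.linearIndepOn huP) (w := w) (r := r)
      (fun G hG => by
        have : G ∉ J := fun hGJ => hG (huJ.2 hGJ)
        simp [r, this]) hwr (huJ.2 hj) (hr j hj).1.ne'
    rw [tightSet_cut_of_eq hly, hjt]
    refine ⟨h1, ?_⟩
    have h4 : (quotOrder (μ '' insert none (some '' (tightSet a b u \ {j}))) : ℚ) <
        quotOrder (A.lam '' tightSet a b u) := by
      rw [h2, abs_of_pos (hr j hj).1]
      exact mul_lt_of_lt_one_left (by exact_mod_cast h3) (hr j hj).2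
    exact_mod_cast h4
  have hind : ∀ x ∈ Q, LinearIndepOn ℤ μ
      (tightSet (cutFun a (l : (Fin n → ℝ) →ₗ[ℝ] ℝ)) (cutBound b c) x) := by
    intro x hx
    -- The tight set at `x` is contained in that at some vertex `y`, so independence need only be
    -- checked at vertices.
    obtain ⟨y, hy, hyx, -⟩ := hQ.exists_vertex_max (hQ.isFace_faceOf
      (J := tightSet (cutFun a (l : (Fin n → ℝ) →ₗ[ℝ] ℝ)) (cutBound b c) x)
      ⟨x, hx, subset_rfl⟩) 0
    refine LinearIndepOn.mono ?_ hyx.2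
    by_cases hly : (l : (Fin n → ℝ) →ₗ[ℝ] ℝ) y = c
    · obtain ⟨u, ⟨⟨hu, huJ⟩, hyu⟩, -⟩ := hc.existsUnique_vertex_under h.toIsSimpleHRep hy hly
      exact (hex u hu huJ y hy hly hyu).1
    · rw [tightSet_cut_of_ne hly]
      exact LinearIndepOn.image_of_comp some μ (h.linearIndepOn hyx.1.1)
  let B : RCharPair n := ofHRep hQ μ hprim hind
  have hvecs : ∀ x ∈ Q, B.vecs {x} =
      μ '' tightSet (cutFun a (l : (Fin n → ℝ) →ₗ[ℝ] ℝ)) (cutBound b c) x := fun x hx =>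
    ofHRep_vecs hQ μ hprim hind hx
  let E : B.Facet := hQ.facetEquiv none
  have hmemE : ∀ x, x ∈ E.1 ↔ x ∈ A.poly ∧ l x = c := by
    intro x
    refine hQ.mem_facetEquiv.trans ?_
    rw [none_mem_tightSet_cut]
    exact ⟨fun hx => ⟨hx.1.1, hx.2⟩, fun hx => ⟨⟨hx.1, hx.2.le⟩, hx.2⟩⟩
  have hlamE : B.lam E = w := by
    change μ (hQ.facetEquiv.symm (hQ.facetEquiv none)) = w
    rw [Equiv.symm_apply_apply]
    rfl
  have hover : ∀ y u, u ∈ A.poly → (y ∈ verticesOver A B E u ↔ y ∈ vertices Q ∧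
      (l : (Fin n → ℝ) →ₗ[ℝ] ℝ) y = c ∧ tightSet a b y ⊆ tightSet a b u) := by
    intro y u huP
    constructor
    · rintro ⟨hy, hyE, hyu⟩
      obtain ⟨hyP, hly⟩ := (hmemE y).1 hyE
      exact ⟨hy, hly, fun G hG => ((h.mem_facet G u).1 (hyu G ((h.mem_facet G y).2 ⟨hyP, hG⟩))).2⟩
    · rintro ⟨hy, hly, hyu⟩
      have hyP : y ∈ A.poly := (hy.1.subset rfl).1
      exact ⟨hy, (hmemE y).2 ⟨hyP, hly⟩, fun G hG =>
        (h.mem_facet G u).2 ⟨huP, hyu ((h.mem_facet G y).1 hG).2⟩⟩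
  have hvertP : ∀ u ∈ vertices A.poly, u ∈ A.poly := fun u hu => hu.1.subset rfl
  let e := Finite.equivFin J
  refine ⟨B, F, l, c, hF, ⟨hface, ?_, hpos, hneg, rfl, ?_⟩, E, ?_, Nat.card J,
    fun i => (e.symm i).1, ?_, ?_, ⟨fun i => q (e.symm i), v, m, ?_, hv0, ?_, hm, ?_⟩, ?_, ?_, ?_,
    ?_⟩
  · -- the functional is not zero
    rintro rfl
    obtain ⟨u, hu, huF, -⟩ := h.exists_vertex_max hface 0
    obtain ⟨y, hy⟩ := hQ.nonempty
    have h1 := hpos u hu huF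
    have h2 : (0 : ℝ) ≤ c := hy.2
    simp only [zero_apply] at h1
    linarith
  · intro G G' hG'
    have h1 : G' = hQ.facetEquiv (some G) := by
      apply Subtype.ext
      rw [hG']
      ext x
      rw [hQ.mem_facetEquiv, Set.mem_inter_iff, h.mem_facet, some_mem_tightSet_cut]
      exact ⟨fun hx => ⟨hx.2, hx.1.2⟩, fun hx => ⟨⟨hx.1.1, hx.2⟩, hx.1⟩⟩
    rw [h1]
    change μ (hQ.facetEquiv.symm (hQ.facetEquiv (some G))) = _
    rw [Equiv.symm_apply_apply]
    rfl
  · ext x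
    exact hmemE x
  · exact Subtype.val_injective.comp e.symm.injective
  · ext G
    constructor
    · rintro ⟨i, rfl⟩
      exact (e.symm i).2
    · intro hG
      exact ⟨e ⟨G, hG⟩, congrArg Subtype.val (e.symm_apply_apply ⟨G, hG⟩)⟩
  · intro i
    rw [abs_of_pos (hq _).1]
    exact hq _
  · intro s
    rw [hvq s]
    exact (e.symm.sum_comp (fun j => q j * (A.lam j.1 s : ℚ))).symm
  · rw [hlamE]
    exact hvw
  · ext u
    have h1 := hc.vertices_diff h.toIsSimpleHRep (v := u)
    rw [← hFJ] at h1
    rw [Set.mem_sdiff, Set.mem_sdiff, ← h1]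
    refine and_congr_right fun hu => not_congr ?_
    rw [hmemE]
    exact and_iff_right (hu.1.subset rfl).1
  · rintro u ⟨hu, huF⟩
    have hlt := hneg u hu huF
    have huP := hvertP u hu
    rw [singOrder_eq, singOrder_eq, h.vecs_singleton huP, hvecs u ⟨huP, hlt.le⟩,
      tightSet_cut_of_ne hlt.ne, Set.image_image]
    rfl
  · rintro y ⟨hy, hyE⟩
    obtain ⟨hyP, hly⟩ := (hmemE y).1 hyE
    obtain ⟨u, ⟨⟨hu, huJ⟩, hyu⟩, huniq⟩ := hc.existsUnique_vertex_under h.toIsSimpleHRep hy hly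
    refine ⟨u, ⟨⟨hu, hFJ ▸ huJ⟩, (hover y u (hvertP u hu)).2 ⟨hy, hly, hyu⟩⟩, ?_⟩
    rintro u' ⟨⟨hu', huF'⟩, hyu'⟩
    exact huniq u' ⟨⟨hu', hFJ ▸ huF'⟩, ((hover y u' (hvertP u' hu')).1 hyu').2.2⟩
  · rintro u ⟨hu, huF⟩
    have huP := hvertP u hu
    have huJ : u ∈ faceOf A.poly a b J := hFJ ▸ huF
    refine ⟨?_, fun y hy => ?_⟩
    · rw [Nat.card_coe_set_eq, ← hc.ncard_vertices_over h.toIsSimpleHRep hu huJ]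
      congr 1
      ext y
      exact hover y u huP
    · obtain ⟨hy1, hly, hyu⟩ := (hover y u huP).1 hy
      rw [singOrder_eq, singOrder_eq, h.vecs_singleton huP, hvecs y (hy1.1.subset rfl)]
      exact (hex u hu huJ y hy1 hly hyu).2

end RCharPair

end

section

variable {n : ℕ}

/-! ### Termination -/

namespace RCharPair

/-- A quantity which decreases in every step of the resolution. -/
def complexity (A : RCharPair n) : ℕ := ∑ᶠ v ∈ vertices A.poly, (n + 1) ^ A.singOrder {v}

theorem finite_vertices (hn : 1 ≤ n) (A : RCharPair n) : (vertices A.poly).Finite := by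
  obtain ⟨a, b, h⟩ := A.exists_isPresentation hn
  exact h.finite_vertices

/-- A vertex of order `g` is replaced by at most `n` vertices of order at most `g - 1`, and `n * (n
+ 1) ^ (g - 1) < (n + 1) ^ g`. This is why the base is `n + 1`. -/
theorem IsResolutionStep.complexity_lt (hn : 1 ≤ n) {A B : RCharPair n}
    (h : A.IsResolutionStep B) : B.complexity < A.complexity := by
  classical
  obtain ⟨F, l, c, hmax, -, E, -, k, i, hi, hrange, -, hdiff, hord, huniq, hover⟩ := h
  obtain ⟨a, b, hA⟩ := A.exists_isPresentation hn
  have hfin := hA.finite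
  have hVA := A.finite_vertices hn
  have hVB := B.finite_vertices hn
  obtain ⟨v₀, hv₀, hv₀F, -⟩ := hA.exists_vertex_max hmax.1.1 0
  -- All facets containing `F` pass through the vertex `v₀`, which lies on exactly `n` facets.
  have hk : k ≤ n := by
    rw [← (hA.mem_vertices_iff_ncard.1 hv₀).2, ← Nat.card_fin k, ← Set.ncard_univ,
      ← Set.ncard_image_of_injective _ hi, Set.image_univ, hrange]
    exact Set.ncard_le_ncard (fun G hG => ((hA.mem_facet G v₀).1 (hG hv₀F)).2) (Set.toFinite _)
  have hsplitA : A.complexity = ∑ v ∈ hVA.toFinset with v ∉ F, (n + 1) ^ A.singOrder {v} +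
      ∑ v ∈ hVA.toFinset with v ∈ F, (n + 1) ^ A.singOrder {v} := by
    rw [complexity, finsum_mem_eq_finite_toFinset_sum _ hVA,
      Finset.sum_filter_not_add_sum_filter]
  have hsplitB : B.complexity = ∑ v ∈ hVB.toFinset with v ∉ E.1, (n + 1) ^ B.singOrder {v} +
      ∑ v ∈ hVB.toFinset with v ∈ E.1, (n + 1) ^ B.singOrder {v} := by
    rw [complexity, finsum_mem_eq_finite_toFinset_sum _ hVB,
      Finset.sum_filter_not_add_sum_filter]
  have hoff : ∑ v ∈ hVB.toFinset with v ∉ E.1, (n + 1) ^ B.singOrder {v} =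
      ∑ v ∈ hVA.toFinset with v ∉ F, (n + 1) ^ A.singOrder {v} := by
    have hset : hVB.toFinset.filter (· ∉ E.1) = hVA.toFinset.filter (· ∉ F) := by
      ext v
      have := Set.ext_iff.1 hdiff v
      simpa using this
    rw [hset]
    refine Finset.sum_congr rfl fun v hv => ?_
    rw [hord v (by simpa using hv)]
  choose! g hg hg' using huniq
  have hon : ∑ w ∈ hVB.toFinset with w ∈ E.1, (n + 1) ^ B.singOrder {w} =
      ∑ v ∈ hVA.toFinset with v ∈ F, ∑ w ∈ hVB.toFinset with w ∈ E.1 ∧ g w = v,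
        (n + 1) ^ B.singOrder {w} := by
    rw [← Finset.sum_fiberwise_of_maps_to (g := g) (t := hVA.toFinset.filter (· ∈ F))]
    · refine Finset.sum_congr rfl fun v _ => ?_
      rw [Finset.filter_filter]
    · intro w hw
      have := (hg w (by simpa using hw)).1
      simpa using this
  rw [hsplitA, hsplitB, hoff, hon]
  refine Nat.add_lt_add_left (Finset.sum_lt_sum_of_nonempty ⟨v₀, by simp [hv₀, hv₀F]⟩ ?_) _
  intro v hv
  have hv : v ∈ vertices A.poly ∩ F := by simpa using hv
  obtain ⟨hcard, hlt⟩ := hover v hv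
  have hmem : ∀ w ∈ hVB.toFinset.filter (fun w => w ∈ E.1 ∧ g w = v),
      w ∈ A.verticesOver B E v := by
    intro w hw
    simp only [Finset.mem_filter, Set.Finite.mem_toFinset] at hw
    obtain ⟨hwB, hwE, rfl⟩ := hw
    exact (hg w ⟨hwB, hwE⟩).2
  have hcard' : (hVB.toFinset.filter (fun w => w ∈ E.1 ∧ g w = v)).card ≤ k := by
    rw [← hcard, ← Set.ncard_coe_finset]
    exact Set.ncard_le_ncard hmem (hVB.subset fun w hw => hw.1)
  -- `Nat.card` is `0` on infinite types, a case not excluded here; then nothing can lie over `v`,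
  -- since no order is below `0`.
  rcases Nat.eq_zero_or_pos (A.singOrder {v}) with h0 | h0
  · rw [Finset.filter_eq_empty_iff.2, Finset.sum_empty]
    · positivity
    · intro w hw hcon
      have := hlt w (hmem w (Finset.mem_filter.2 ⟨hw, hcon⟩))
      omega
  calc ∑ w ∈ hVB.toFinset with w ∈ E.1 ∧ g w = v, (n + 1) ^ B.singOrder {w}
      ≤ ∑ w ∈ hVB.toFinset with w ∈ E.1 ∧ g w = v, (n + 1) ^ (A.singOrder {v} - 1) := by
        refine Finset.sum_le_sum fun w hw => Nat.pow_le_pow_right (Nat.succ_pos n) ?_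
        have := hlt w (hmem w hw)
        omega
    _ ≤ n * (n + 1) ^ (A.singOrder {v} - 1) := by
        rw [Finset.sum_const, smul_eq_mul]
        exact Nat.mul_le_mul_right _ (hcard'.trans hk)
    _ < (n + 1) * (n + 1) ^ (A.singOrder {v} - 1) :=
        Nat.mul_lt_mul_of_pos_right (Nat.lt_succ_self n) (by positivity)
    _ = (n + 1) ^ A.singOrder {v} := by
        rw [← pow_succ', Nat.sub_add_cancel h0]

/-- If there is a singular face, then there is a maximal one. -/
theorem exists_isMaximalSingular (hn : 1 ≤ n) (A : RCharPair n) {F : Set (Fin n → ℝ)}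
    (hF : IsFace A.poly F) (hsing : A.singOrder F ≠ 1) : ∃ G, A.IsMaximalSingular G := by
  obtain ⟨a, b, h⟩ := A.exists_isPresentation hn
  have hfin := h.finite
  have hfaces : {G | IsFace A.poly G ∧ A.singOrder G ≠ 1}.Finite :=
    (Set.finite_range (faceOf A.poly a b)).subset fun G hG => ⟨_, (h.eq_faceOf_setOf hG.1).symm⟩
  exact hfaces.exists_maximal ⟨F, hF, hsing⟩

end RCharPair

end

/-! ### The toric manifold: smooth charts at nonsingular vertices. -/

section

variable {n : ℕ}

/-! ### Homomorphisms of tori -/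

theorem prod_zpow_eq_zpow_sum {G κ : Type*} [CommGroup G] (s : Finset κ) (f : κ → ℤ) (g : G) :
    ∏ i ∈ s, g ^ f i = g ^ ∑ i ∈ s, f i := by
  classical
  induction s using Finset.induction_on with
  | empty => simp
  | insert i s hi ih => rw [Finset.prod_insert hi, Finset.sum_insert hi, ih, zpow_add]

/-- The homomorphism of tori given by an integer matrix. -/
def torusMap (M : Matrix (Fin n) (Fin n) ℤ) : (Fin n → Circle) →* (Fin n → Circle) where
  toFun t i := ∏ j, t j ^ M i j
  map_one' := by
    ext i
    simp
  map_mul' s t := by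
    ext i
    simp [mul_zpow, Finset.prod_mul_distrib]

theorem torusMap_apply (M : Matrix (Fin n) (Fin n) ℤ) (t : Fin n → Circle) (i : Fin n) :
    torusMap M t i = ∏ j, t j ^ M i j := rfl

theorem torusMap_mul (M N : Matrix (Fin n) (Fin n) ℤ) (t : Fin n → Circle) :
    torusMap (M * N) t = torusMap M (torusMap N t) := by
  funext i
  simp only [torusMap_apply, Matrix.mul_apply, ← Finset.prod_zpow, ← zpow_mul]
  rw [Finset.prod_comm]
  refine Finset.prod_congr rfl fun k _ => ?_
  rw [prod_zpow_eq_zpow_sum]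
  simp only [mul_comm]

theorem torusMap_one (t : Fin n → Circle) : torusMap 1 t = t := by
  funext i
  rw [torusMap_apply, Finset.prod_eq_single i]
  · simp
  · intro j _ hj
    simp [Matrix.one_apply_ne hj.symm]
  · simp

theorem continuous_torusMap (M : Matrix (Fin n) (Fin n) ℤ) : Continuous (torusMap M) :=
  continuous_pi fun i => by
    simp only [torusMap_apply]
    fun_prop

/-- Mutually inverse integer matrices give automorphisms of the torus. -/
def torusEquiv (M N : Matrix (Fin n) (Fin n) ℤ) (hMN : M * N = 1) (hNM : N * M = 1) :
    (Fin n → Circle) ≃ₜ* (Fin n → Circle) where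
  toFun := torusMap M
  invFun := torusMap N
  left_inv t := by rw [← torusMap_mul, hNM, torusMap_one]
  right_inv t := by rw [← torusMap_mul, hMN, torusMap_one]
  map_mul' := map_mul _
  continuous_toFun := continuous_torusMap M
  continuous_invFun := continuous_torusMap N

theorem mem_circleSubgroup {v : Fin n → ℤ} {t : Fin n → Circle} :
    t ∈ RCharPair.circleSubgroup v ↔ ∃ z : Circle, (fun i => z ^ v i) = t := Iff.rfl

theorem torusMap_circle (M : Matrix (Fin n) (Fin n) ℤ) (v : Fin n → ℤ) (z : Circle) :
    torusMap M (fun i => z ^ v i) = fun i => z ^ (M.mulVec v) i := by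
  funext i
  simp only [torusMap_apply, ← zpow_mul, prod_zpow_eq_zpow_sum, Matrix.mulVec, dotProduct]
  simp only [mul_comm]

/-! ### Phases of complex numbers -/

/-- The phase of a complex number. -/
def phase (z : ℂ) : Circle := Circle.exp z.arg

theorem norm_mul_phase (z : ℂ) : (‖z‖ : ℂ) * phase z = z := by
  rw [phase, Circle.coe_exp, Complex.norm_mul_exp_arg_mul_I]

theorem coe_phase {z : ℂ} (hz : z ≠ 0) : (phase z : ℂ) = z / ‖z‖ := by
  rw [eq_div_iff (Complex.ofReal_ne_zero.2 (norm_ne_zero_iff.2 hz)), mul_comm, norm_mul_phase]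

/-! ### Corners -/

namespace RCharPair

/-- A vertex of a pair, a numbering of the facets through it, and the dual bases of the normals and
of the vectors of these facets. -/
structure Corner (A : RCharPair n) (a : A.Facet → (Fin n → ℝ) →ₗ[ℝ] ℝ) (b : A.Facet → ℝ) where
  /-- the vertex -/
  pt : Fin n → ℝ
  mem_vertices : pt ∈ vertices A.poly
  /-- the facets through the vertex -/
  facet : Fin n ≃ tightSet a b pt
  /-- the directions of the edges at the vertex -/
  dir : Fin n → Fin n → ℝ
  -- The sign `-1` makes the directions point into the polytope, so that the affine coordinates `b -
  -- a` are nonnegative on it.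
  apply_dir : ∀ i j, a (facet i) (dir j) = if i = j then -1 else 0
  /-- the inverse of the matrix whose columns are the vectors of the facets -/
  mat : Matrix (Fin n) (Fin n) ℤ
  mat_mul : mat * Matrix.of (fun i j => A.lam (facet j).1 i) = 1

variable {A : RCharPair n} {a : A.Facet → (Fin n → ℝ) →ₗ[ℝ] ℝ} {b : A.Facet → ℝ}

/-- Order one means determinant `±1`, so the matrix of vectors is invertible over `ℤ`. -/
theorem IsPresentation.exists_corner (h : A.IsPresentation a b) {v : Fin n → ℝ}
    (hv : v ∈ vertices A.poly) (hs : A.singOrder {v} = 1) : ∃ C : Corner A a b, C.pt = v := by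
  classical
  have hfin := h.finite
  have := Fintype.ofFinite A.Facet
  obtain ⟨hvP, hcard⟩ := h.mem_vertices_iff_ncard.1 hv
  obtain ⟨σ⟩ : Nonempty (Fin n ≃ tightSet a b v) := by
    rw [← Fintype.card_eq, Fintype.card_fin, ← Nat.card_eq_fintype_card, Nat.card_coe_set_eq,
      hcard]
  have hu : LinearIndependent ℤ (fun j => A.lam (σ j).1) :=
    (h.linearIndepOn hvP).linearIndependent.comp σ σ.injective
  have hrange : Set.range (fun j => A.lam (σ j).1) = A.lam '' tightSet a b v := by
    rw [Set.image_eq_range]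
    exact σ.surjective.range_comp (fun G : tightSet a b v => A.lam G.1)
  have hdet : IsUnit (Matrix.of (fun i j => A.lam (σ j).1 i)).det := by
    rw [← Matrix.det_transpose, Int.isUnit_iff_natAbs_eq]
    have h1 := quotOrder_range hu
    rw [hrange, ← h.vecs_singleton hvP, ← singOrder_eq, hs] at h1
    exact h1.symm
  choose d hd using fun j => h.exists_dir hvP (fun G => if G = (σ j).1 then -1 else 0)
  exact ⟨{
    pt := v
    mem_vertices := hv
    facet := σ
    dir := d
    apply_dir := fun i j => by
      rw [hd j _ (σ i).2]
      simp [← Subtype.ext_iff]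
    mat := (Matrix.of (fun i j => A.lam (σ j).1 i))⁻¹
    mat_mul := Matrix.nonsing_inv_mul _ hdet }, rfl⟩

namespace Corner

variable (C : Corner A a b)

theorem pt_mem : C.pt ∈ A.poly := C.mem_vertices.1.subset rfl

/-- The matrix whose columns are the vectors of the facets through the corner. -/
def colMat : Matrix (Fin n) (Fin n) ℤ := Matrix.of fun i j => A.lam (C.facet j).1 i

theorem mat_mul_colMat : C.mat * C.colMat = 1 := C.mat_mul

theorem colMat_mul_mat : C.colMat * C.mat = 1 := mul_eq_one_comm.1 C.mat_mul

theorem mat_mulVec (j : Fin n) : C.mat.mulVec (A.lam (C.facet j).1) = Pi.single j 1 := by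
  funext i
  have := congrFun (congrFun C.mat_mul i) j
  rw [Matrix.mul_apply, Matrix.one_apply] at this
  rw [Pi.single_apply]
  exact this

/-- The affine coordinates at the corner. -/
def coord (x : Fin n → ℝ) (j : Fin n) : ℝ := b (C.facet j) - a (C.facet j) x

/-- The point with given affine coordinates. -/
def point (y : Fin n → ℝ) : Fin n → ℝ := C.pt + ∑ j, y j • C.dir j

theorem coord_point (y : Fin n → ℝ) : C.coord (C.point y) = y := by
  funext j
  have h1 : a (C.facet j) C.pt = b (C.facet j) := (C.facet j).2
  simp [coord, point, h1, C.apply_dir]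

theorem apply_facet_point (y : Fin n → ℝ) (j : Fin n) :
    a (C.facet j) (C.point y) = b (C.facet j) - y j := by
  have := congrFun (C.coord_point y) j
  rw [coord] at this
  linarith

theorem point_coord (h : A.IsPresentation a b) (x : Fin n → ℝ) : C.point (C.coord x) = x := by
  refine sub_eq_zero.1 ((h.mem_vertices_iff.1 C.mem_vertices).2 _ fun G hG => ?_)
  have h1 := C.apply_facet_point (C.coord x) (C.facet.symm ⟨G, hG⟩)
  rw [coord, Equiv.apply_symm_apply] at h1
  rw [map_sub, h1]
  ring

theorem coord_nonneg (h : A.IsPresentation a b) {x : Fin n → ℝ} (hx : x ∈ A.poly) (j : Fin n) :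
    0 ≤ C.coord x j :=
  sub_nonneg.2 ((h.mem_iff x).1 hx _)

theorem coord_eq_zero_iff {x : Fin n → ℝ} {j : Fin n} :
    C.coord x j = 0 ↔ (C.facet j).1 ∈ tightSet a b x := by
  rw [coord, sub_eq_zero, mem_tightSet, eq_comm]

theorem continuous_coord : Continuous C.coord :=
  continuous_pi fun j => continuous_const.sub (a (C.facet j)).continuous_of_finiteDimensional

theorem continuous_point : Continuous C.point := by
  unfold point
  fun_prop

/-- The points which lie only on facets through the corner. -/
def nbhd : Set (Fin n → ℝ) := {x | ∀ G ∉ tightSet a b C.pt, a G x < b G}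

theorem isOpen_nbhd (h : A.IsPresentation a b) : IsOpen C.nbhd := by
  have := h.finite
  have : C.nbhd = ⋂ G ∈ (tightSet a b C.pt)ᶜ, {x | a G x < b G} := by
    ext x
    simp [nbhd]
  rw [this]
  exact (Set.toFinite _).isOpen_biInter fun G _ =>
    isOpen_lt (a G).continuous_of_finiteDimensional continuous_const

theorem mem_nbhd_iff (h : A.IsPresentation a b) {x : Fin n → ℝ} (hx : x ∈ A.poly) :
    x ∈ C.nbhd ↔ tightSet a b x ⊆ tightSet a b C.pt := by
  constructor
  · intro hxn G hG
    by_contra hGv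
    exact (hxn G hGv).ne hG
  · intro hs G hG
    exact lt_of_le_of_ne ((h.mem_iff x).1 hx G) fun he => hG (hs he)

theorem point_mem (h : A.IsPresentation a b) {y : Fin n → ℝ} (hy : ∀ j, 0 ≤ y j)
    (hn : C.point y ∈ C.nbhd) : C.point y ∈ A.poly := by
  rw [h.mem_iff]
  intro G
  by_cases hG : G ∈ tightSet a b C.pt
  · have h1 := C.apply_facet_point y (C.facet.symm ⟨G, hG⟩)
    rw [Equiv.apply_symm_apply] at h1
    have h2 := hy (C.facet.symm ⟨G, hG⟩)
    linarith
  · exact (hn G hG).le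

/-- Near a corner, the stabilizers are coordinate subtori. -/
theorem mem_faceTorus_iff (h : A.IsPresentation a b) {x : Fin n → ℝ} (hx : x ∈ A.poly)
    (hxn : x ∈ C.nbhd) {t : Fin n → Circle} :
    t ∈ A.faceTorus {x} ↔ ∀ j, C.coord x j ≠ 0 → torusMap C.mat t j = 1 := by
  rw [C.mem_nbhd_iff h hx] at hxn
  constructor
  · intro ht
    -- In the coordinates given by `C.mat` the circle of the `i`-th facet becomes the `i`-th
    -- coordinate circle, so each generator lies in `K`.
    let K : Subgroup (Fin n → Circle) :=
      (Subgroup.pi {j | C.coord x j ≠ 0} fun _ => ⊥).comap (torusMap C.mat)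
    have hle : A.faceTorus {x} ≤ K := by
      refine iSup_le ?_
      rintro ⟨G, hG⟩ t ht
      obtain ⟨z, rfl⟩ := mem_circleSubgroup.1 ht
      have hGx : G ∈ tightSet a b x := ((h.mem_facet G x).1 (hG rfl)).2
      obtain ⟨i, hi⟩ := C.facet.surjective ⟨G, hxn hGx⟩
      have hi' : (C.facet i).1 = G := congrArg Subtype.val hi
      change torusMap C.mat _ ∈ Subgroup.pi _ _
      rw [Subgroup.mem_pi]
      intro j hj
      have hji : j ≠ i := by
        rintro rfl
        exact hj (C.coord_eq_zero_iff.2 (hi' ▸ hGx))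
      rw [Subgroup.mem_bot, torusMap_circle]
      dsimp only
      rw [← hi', C.mat_mulVec, Pi.single_eq_of_ne hji, zpow_zero]
    intro j hj
    have h1 : torusMap C.mat t ∈ Subgroup.pi {j | C.coord x j ≠ 0} fun _ => ⊥ := hle ht
    rw [Subgroup.mem_pi] at h1
    exact Subgroup.mem_bot.1 (h1 j hj)
  · intro ht
    -- Conversely `t` is the product of its components along the facet circles, and those with
    -- nonzero affine coordinate are trivial.
    have h1 : t = ∏ j, fun i => torusMap C.mat t j ^ A.lam (C.facet j).1 i := by
      have h2 : t = torusMap C.colMat (torusMap C.mat t) := by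
        rw [← torusMap_mul, C.colMat_mul_mat, torusMap_one]
      conv_lhs => rw [h2]
      funext i
      rw [torusMap_apply, Finset.prod_apply]
      rfl
    rw [h1]
    refine Subgroup.prod_mem _ fun j _ => ?_
    by_cases hj : C.coord x j = 0
    · have hjx := C.coord_eq_zero_iff.1 hj
      have hsub : {x} ⊆ (C.facet j).1.1 :=
        Set.singleton_subset_iff.2 ((h.mem_facet _ x).2 ⟨hx, hjx⟩)
      exact Subgroup.mem_iSup_of_mem (S := fun G : {G : A.Facet // {x} ⊆ G.1} =>
        circleSubgroup (A.lam G.1)) ⟨(C.facet j).1, hsub⟩ (mem_circleSubgroup.2 ⟨_, rfl⟩)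
    · have h3 : (fun i => torusMap C.mat t j ^ A.lam (C.facet j).1 i) = 1 := by
        funext i
        rw [ht j hj, one_zpow]
        rfl
      rw [h3]
      exact one_mem _

end Corner
end RCharPair

end

section

variable {n : ℕ}

namespace RCharPair

variable {A : RCharPair n} {a : A.Facet → (Fin n → ℝ) →ₗ[ℝ] ℝ} {b : A.Facet → ℝ}

/-! ### The space of a pair -/

/-- The class of a point of `Tⁿ × P`. -/
def proj (A : RCharPair n) (p : (Fin n → Circle) × A.poly) : A.Space := Quotient.mk A.toricSetoid p

theorem proj_surjective (A : RCharPair n) : Function.Surjective A.proj := Quotient.mk_surjective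

theorem isQuotientMap_proj (A : RCharPair n) : IsQuotientMap A.proj := isQuotientMap_quotient_mk'

theorem proj_eq_iff {p q : (Fin n → Circle) × A.poly} :
    A.proj p = A.proj q ↔ p.2 = q.2 ∧ p.1⁻¹ * q.1 ∈ A.faceTorus {p.2.1} := Quotient.eq

theorem smul_proj (t : Fin n → Circle) (p : (Fin n → Circle) × A.poly) :
    t • A.proj p = A.proj (t * p.1, p.2) := rfl

theorem orbitMap_smul (t : Fin n → Circle) (m : A.Space) :
    A.orbitMap (t • m) = A.orbitMap m := by
  obtain ⟨p, rfl⟩ := A.proj_surjective m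
  rfl

theorem continuous_orbitMap (A : RCharPair n) : Continuous A.orbitMap :=
  A.isQuotientMap_proj.continuous_iff.2 continuous_snd

theorem orbitMap_surjective (A : RCharPair n) : Function.Surjective A.orbitMap :=
  fun x => ⟨A.proj (1, x), rfl⟩

theorem orbitMap_eq_orbitMap_iff (m m' : A.Space) :
    A.orbitMap m = A.orbitMap m' ↔ ∃ t : Fin n → Circle, t • m = m' := by
  constructor
  · obtain ⟨⟨s, x⟩, rfl⟩ := A.proj_surjective m
    obtain ⟨⟨s', x'⟩, rfl⟩ := A.proj_surjective m'
    intro hx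
    have hx : x = x' := hx
    subst hx
    exact ⟨s' * s⁻¹, by rw [smul_proj]; simp⟩
  · rintro ⟨t, rfl⟩
    exact (orbitMap_smul t m).symm

/-! ### The chart at a corner -/

namespace Corner

variable (C : Corner A a b)

/-- The chart at a corner, on `Tⁿ × P`. -/
def preChart (p : (Fin n → Circle) × A.poly) (j : Fin n) : ℂ :=
  -- With the square root, `‖z j‖ ^ 2` is an affine coordinate on `P` and hence smooth in `z`.
  (√(C.coord p.2 j) : ℝ) * torusMap C.mat p.1 j

theorem continuous_preChart : Continuous C.preChart := by
  refine continuous_pi fun j => ?_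
  have h1 : Continuous fun p : (Fin n → Circle) × A.poly => √(C.coord p.2 j) :=
    Real.continuous_sqrt.comp
      ((continuous_apply j).comp (C.continuous_coord.comp (continuous_subtype_val.comp
        continuous_snd)))
  have h2 : Continuous fun p : (Fin n → Circle) × A.poly => torusMap C.mat p.1 j :=
    (continuous_apply j).comp ((continuous_torusMap C.mat).comp continuous_fst)
  exact (Complex.continuous_ofReal.comp h1).mul (continuous_subtype_val.comp h2)

/-- The squares of the absolute values of the coordinates. -/
def sqNorm (z : Fin n → ℂ) (j : Fin n) : ℝ := ‖z j‖ ^ 2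

theorem sqNorm_preChart (h : A.IsPresentation a b) (p : (Fin n → Circle) × A.poly) :
    sqNorm (C.preChart p) = C.coord p.2 := by
  funext j
  simp [sqNorm, preChart, Circle.norm_coe, Real.sq_sqrt (C.coord_nonneg h p.2.2 j)]

theorem point_sqNorm_preChart (h : A.IsPresentation a b) (p : (Fin n → Circle) × A.poly) :
    C.point (sqNorm (C.preChart p)) = p.2 := by
  rw [C.sqNorm_preChart h, C.point_coord h]

/-- The moduli determine the point of `P`. The phases determine the torus element up to the
coordinates with zero modulus, which form exactly the stabilizer. -/
theorem preChart_eq_iff (h : A.IsPresentation a b) {p q : (Fin n → Circle) × A.poly}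
    (hp : p.2.1 ∈ C.nbhd) : C.preChart p = C.preChart q ↔ A.proj p = A.proj q := by
  rw [proj_eq_iff, C.mem_faceTorus_iff h p.2.2 hp]
  constructor
  · intro he
    have h1 : p.2 = q.2 := Subtype.ext (by
      rw [← C.point_sqNorm_preChart h p, ← C.point_sqNorm_preChart h q, he])
    refine ⟨h1, fun j hj => ?_⟩
    have h2 := congrFun he j
    have h3 : ((√(C.coord p.2 j) : ℝ) : ℂ) ≠ 0 := by
      rw [Complex.ofReal_ne_zero]
      exact (Real.sqrt_pos.2 (lt_of_le_of_ne (C.coord_nonneg h p.2.2 j) hj.symm)).ne'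
    simp only [preChart, ← h1] at h2
    have h4 := Circle.ext (mul_left_cancel₀ h3 h2)
    rw [map_mul, map_inv, Pi.mul_apply, Pi.inv_apply, h4, inv_mul_cancel]
  · rintro ⟨h1, h2⟩
    funext j
    simp only [preChart, ← h1]
    by_cases hj : C.coord p.2 j = 0
    · simp [hj]
    · have h3 := h2 j hj
      rw [map_mul, map_inv, Pi.mul_apply, Pi.inv_apply, inv_mul_eq_one] at h3
      rw [h3]

/-- The domain of the chart. -/
def chartSource : Set A.Space := {m | (A.orbitMap m).1 ∈ C.nbhd}

/-- The image of the chart. -/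
def chartTarget : Set (Fin n → ℂ) := {z | C.point (sqNorm z) ∈ C.nbhd}

/-- The chart as a map. -/
def chartFun : A.Space → (Fin n → ℂ) := fun m =>
  -- An arbitrary lift: on `chartSource` the value does not depend on it, elsewhere it is a default.
  C.preChart (Function.surjInv A.proj_surjective m)

theorem chartFun_proj (h : A.IsPresentation a b) {p : (Fin n → Circle) × A.poly}
    (hp : p.2.1 ∈ C.nbhd) : C.chartFun (A.proj p) = C.preChart p :=
  ((C.preChart_eq_iff h hp).2 (Function.surjInv_eq A.proj_surjective _).symm).symm

open Classical in
/-- The inverse of the chart. -/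
def chartInv (z : Fin n → ℂ) : A.Space :=
  A.proj (torusMap C.colMat fun j => phase (z j),
    -- The corner itself is only a default value, never used on `chartTarget`.
    if hz : C.point (sqNorm z) ∈ A.poly then ⟨_, hz⟩ else ⟨C.pt, C.pt_mem⟩)

theorem point_mem_of_mem_target (h : A.IsPresentation a b) {z : Fin n → ℂ}
    (hz : z ∈ C.chartTarget) : C.point (sqNorm z) ∈ A.poly :=
  C.point_mem h (fun _ => sq_nonneg _) hz

theorem chartInv_of_mem (h : A.IsPresentation a b) {z : Fin n → ℂ} (hz : z ∈ C.chartTarget) :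
    C.chartInv z = A.proj (torusMap C.colMat fun j => phase (z j),
      ⟨_, C.point_mem_of_mem_target h hz⟩) := by
  rw [chartInv, dif_pos (C.point_mem_of_mem_target h hz)]

theorem preChart_inv (z : Fin n → ℂ) (hz : C.point (sqNorm z) ∈ A.poly) :
    C.preChart (torusMap C.colMat fun j => phase (z j), ⟨_, hz⟩) = z := by
  funext j
  have h1 : C.coord (C.point (sqNorm z)) j = ‖z j‖ ^ 2 := congrFun (C.coord_point _) j
  rw [preChart, ← torusMap_mul, C.mat_mul_colMat, torusMap_one]
  simp only [h1, Real.sqrt_sq (norm_nonneg _), norm_mul_phase]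

theorem chartInv_mem_source (h : A.IsPresentation a b) {z : Fin n → ℂ}
    (hz : z ∈ C.chartTarget) : C.chartInv z ∈ C.chartSource := by
  rw [C.chartInv_of_mem h hz]
  exact hz

theorem chartFun_chartInv (h : A.IsPresentation a b) {z : Fin n → ℂ}
    (hz : z ∈ C.chartTarget) : C.chartFun (C.chartInv z) = z := by
  rw [C.chartInv_of_mem h hz]
  exact (C.chartFun_proj h (p := (_, ⟨_, C.point_mem_of_mem_target h hz⟩)) hz).trans
    (C.preChart_inv _ _)

theorem preChart_mem_target_iff (h : A.IsPresentation a b) {p : (Fin n → Circle) × A.poly} :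
    C.preChart p ∈ C.chartTarget ↔ p.2.1 ∈ C.nbhd := by
  change C.point (sqNorm (C.preChart p)) ∈ C.nbhd ↔ _
  rw [C.point_sqNorm_preChart h]

theorem chartInv_preChart (h : A.IsPresentation a b) {p : (Fin n → Circle) × A.poly}
    (hp : p.2.1 ∈ C.nbhd) : C.chartInv (C.preChart p) = A.proj p := by
  have hz := (C.preChart_mem_target_iff h).2 hp
  rw [C.chartInv_of_mem h hz]
  rw [eq_comm, ← C.preChart_eq_iff h hp, C.preChart_inv]

theorem continuous_sqNorm : Continuous (sqNorm (n := n)) := by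
  unfold sqNorm
  fun_prop

theorem isOpen_chartSource (h : A.IsPresentation a b) : IsOpen C.chartSource :=
  (C.isOpen_nbhd h).preimage (continuous_subtype_val.comp A.continuous_orbitMap)

theorem isOpen_chartTarget (h : A.IsPresentation a b) : IsOpen C.chartTarget :=
  (C.isOpen_nbhd h).preimage (C.continuous_point.comp continuous_sqNorm)

theorem continuousOn_chartFun (h : A.IsPresentation a b) :
    ContinuousOn C.chartFun C.chartSource := by
  rw [A.isQuotientMap_proj.continuousOn_isOpen_iff (C.isOpen_chartSource h)]
  exact C.continuous_preChart.continuousOn.congr fun p hp => C.chartFun_proj h hp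

/-- `phase` is discontinuous, so continuity is obtained otherwise: `preChart` is a closed map from a
compact space, and preimages under the inverse chart are images under `preChart`. -/
theorem continuousOn_chartInv (h : A.IsPresentation a b) :
    ContinuousOn C.chartInv C.chartTarget := by
  have hcomp : CompactSpace A.poly := isCompact_iff_compactSpace.1 h.isCompact
  rw [continuousOn_iff_isClosed]
  intro t ht
  refine ⟨C.preChart '' (A.proj ⁻¹' t), C.continuous_preChart.isClosedMap _
    (ht.preimage A.isQuotientMap_proj.continuous), ?_⟩
  ext z
  constructor
  · rintro ⟨hzt, hz⟩
    refine ⟨⟨(torusMap C.colMat fun j => phase (z j), ⟨_, C.point_mem_of_mem_target h hz⟩), ?_,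
      C.preChart_inv _ _⟩, hz⟩
    rw [Set.mem_preimage, ← C.chartInv_of_mem h hz]
    exact hzt
  · rintro ⟨⟨p, hp, rfl⟩, hz⟩
    refine ⟨?_, hz⟩
    rw [Set.mem_preimage, C.chartInv_preChart h ((C.preChart_mem_target_iff h).1 hz)]
    exact hp

/-- The chart at a corner. -/
def chart (h : A.IsPresentation a b) : OpenPartialHomeomorph A.Space (Fin n → ℂ) where
  toFun := C.chartFun
  invFun := C.chartInv
  source := C.chartSource
  target := C.chartTarget
  map_source' m hm := by
    obtain ⟨p, rfl⟩ := A.proj_surjective m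
    rw [C.chartFun_proj h hm]
    exact (C.preChart_mem_target_iff h).2 hm
  map_target' z hz := C.chartInv_mem_source h hz
  left_inv' m hm := by
    obtain ⟨p, rfl⟩ := A.proj_surjective m
    rw [C.chartFun_proj h hm, C.chartInv_preChart h hm]
  right_inv' z hz := C.chartFun_chartInv h hz
  open_source := C.isOpen_chartSource h
  open_target := C.isOpen_chartTarget h
  continuousOn_toFun := C.continuousOn_chartFun h
  continuousOn_invFun := C.continuousOn_chartInv h

theorem smul_mem_chartSource {m : A.Space} (hm : m ∈ C.chartSource) (t : Fin n → Circle) :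
    t • m ∈ C.chartSource := by
  change (A.orbitMap (t • m)).1 ∈ C.nbhd
  rw [orbitMap_smul]
  exact hm

theorem chartFun_smul (h : A.IsPresentation a b) {m : A.Space} (hm : m ∈ C.chartSource)
    (t : Fin n → Circle) :
    C.chartFun (t • m) = fun j => (torusMap C.mat t j : ℂ) * C.chartFun m j := by
  obtain ⟨p, rfl⟩ := A.proj_surjective m
  rw [smul_proj, C.chartFun_proj h (p := (t * p.1, p.2)) hm, C.chartFun_proj h hm]
  funext j
  simp only [preChart, map_mul, Pi.mul_apply, Circle.coe_mul]
  ring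

end Corner
end RCharPair

end

section

variable {n : ℕ}

/-! ### Smoothness of the coordinate changes -/

theorem contDiffOn_div_norm_zpow {E : Type*} [NormedAddCommGroup E] [NormedSpace ℝ E]
    {f : E → ℂ} {s : Set E} (hf : ContDiffOn ℝ ∞ f s) (h0 : ∀ x ∈ s, f x ≠ 0) (m : ℤ) :
    ContDiffOn ℝ ∞ (fun x => (f x / (‖f x‖ : ℂ)) ^ m) s := by
  have h1 : ContDiffOn ℝ ∞ (fun x => f x / (‖f x‖ : ℂ)) s := by
    have h2 : ContDiffOn ℝ ∞ (fun x => ‖f x‖⁻¹ • f x) s :=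
      ((hf.norm ℝ h0).inv fun x hx => norm_ne_zero_iff.2 (h0 x hx)).smul hf
    refine h2.congr fun x _ => ?_
    rw [Complex.real_smul, Complex.ofReal_inv, div_eq_inv_mul]
  have hne : ∀ x ∈ s, f x / (‖f x‖ : ℂ) ≠ 0 := fun x hx =>
    div_ne_zero (h0 x hx) (Complex.ofReal_ne_zero.2 (norm_ne_zero_iff.2 (h0 x hx)))
  cases m with
  | ofNat m => simpa using h1.pow m
  | negSucc m =>
    simp only [zpow_negSucc]
    exact (h1.pow (m + 1)).inv fun x hx => pow_ne_zero _ (hne x hx)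

namespace RCharPair

variable {A : RCharPair n} {a : A.Facet → (Fin n → ℝ) →ₗ[ℝ] ℝ} {b : A.Facet → ℝ}

namespace Corner

variable (C D : Corner A a b)

theorem contDiff_coord_point (j : Fin n) :
    ContDiff ℝ ∞ fun z : Fin n → ℂ => D.coord (C.point (sqNorm z)) j := by
  have h1 : ContDiff ℝ ∞ fun z : Fin n → ℂ => C.point (sqNorm z) := by
    unfold point sqNorm
    refine contDiff_const.add (ContDiff.sum fun i _ => ?_)
    have h2 : ContDiff ℝ ∞ fun z : Fin n → ℂ => ‖z i‖ ^ 2 := (contDiff_apply ℝ ℂ i).norm_sq ℝ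
    exact h2.smul contDiff_const
  unfold coord
  exact contDiff_const.sub ((LinearMap.toContinuousLinearMap (a (D.facet j))).contDiff.comp h1)

/-- The coordinate change between two corners is smooth. -/
theorem contDiffOn_transition (h : A.IsPresentation a b) :
    ContDiffOn ℝ ∞ (fun z => D.chartFun (C.chartInv z))
      {z | z ∈ C.chartTarget ∧ C.point (sqNorm z) ∈ D.nbhd} := by
  classical
  set S : Set (Fin n → ℂ) := {z | z ∈ C.chartTarget ∧ C.point (sqNorm z) ∈ D.nbhd} with hS
  rw [contDiffOn_pi]
  intro j
  let N : Matrix (Fin n) (Fin n) ℤ := D.mat * C.colMat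
  -- the coordinates which do not vanish
  let K : Finset (Fin n) := Finset.univ.filter fun k => (C.facet k).1 ∉ tightSet a b D.pt
  have hK : ∀ k ∈ K, ∀ z ∈ S, z k ≠ 0 := by
    intro k hk z hz h0
    have h1 := hz.2 _ (Finset.mem_filter.1 hk).2
    rw [C.apply_facet_point] at h1
    simp [sqNorm, h0] at h1
  -- Facets through both corners have the same vectors on both sides, so their columns of the
  -- transition matrix are unit vectors. Only phases of nonvanishing coordinates enter with other
  -- exponents.
  have hN : ∀ k ∉ K, N j k = if (C.facet k).1 = (D.facet j).1 then 1 else 0 := by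
    intro k hk
    have hk' : (C.facet k).1 ∈ tightSet a b D.pt := by
      by_contra hcon
      exact hk (Finset.mem_filter.2 ⟨Finset.mem_univ _, hcon⟩)
    obtain ⟨i, hi⟩ := D.facet.surjective ⟨_, hk'⟩
    have hi' : (D.facet i).1 = (C.facet k).1 := congrArg Subtype.val hi
    have h1 : N j k = D.mat.mulVec (A.lam (C.facet k).1) j := rfl
    rw [h1, ← hi', D.mat_mulVec, Pi.single_apply]
    refine if_congr ?_ rfl rfl
    rw [← Subtype.ext_iff, D.facet.apply_eq_iff_eq, eq_comm]
  let g : (Fin n → ℂ) → ℂ := fun z => ∏ k ∈ K, (z k / (‖z k‖ : ℂ)) ^ N j k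
  have hg : ContDiffOn ℝ ∞ g S := contDiffOn_prod fun k hk =>
    contDiffOn_div_norm_zpow (contDiff_apply ℝ ℂ k).contDiffOn (hK k hk) _
  -- the formula for the coordinate change
  have hform : ∀ z ∈ S, D.chartFun (C.chartInv z) j =
      (√(D.coord (C.point (sqNorm z)) j) : ℝ) *
        ((∏ k ∈ Finset.univ.filter (· ∉ K), (phase (z k) : ℂ) ^ N j k) * g z) := by
    intro z hz
    rw [C.chartInv_of_mem h hz.1]
    have h1 := congrFun (D.chartFun_proj h (p := (torusMap C.colMat fun j => phase (z j),
      ⟨_, C.point_mem_of_mem_target h hz.1⟩)) hz.2) j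
    rw [h1, preChart, ← torusMap_mul, torusMap_apply]
    congr 1
    have h2 : g z = ∏ k ∈ Finset.univ.filter (· ∈ K), (phase (z k) : ℂ) ^ N j k := by
      rw [Finset.filter_mem_eq_inter, Finset.univ_inter]
      exact Finset.prod_congr rfl fun k hk => by rw [coe_phase (hK k hk z hz)]
    rw [h2, Finset.prod_filter_not_mul_prod_filter]
    have h3 := map_prod Circle.coeHom (fun k => phase (z k) ^ N j k) Finset.univ
    refine h3.trans (Finset.prod_congr rfl fun k _ => ?_)
    exact Circle.coe_zpow _ _
  by_cases hj : (D.facet j).1 ∈ tightSet a b C.pt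
  · -- the facet passes through both corners
    obtain ⟨k₀, hk₀⟩ := C.facet.surjective ⟨_, hj⟩
    have hk₀' : (C.facet k₀).1 = (D.facet j).1 := congrArg Subtype.val hk₀
    have hk₀K : k₀ ∉ K := fun hk => (Finset.mem_filter.1 hk).2 (hk₀' ▸ (D.facet j).2)
    -- Here the square root is `‖z k₀‖`, which combines with the phase of `z k₀` to the smooth
    -- function `z k₀`.
    refine ((contDiff_apply ℝ ℂ k₀).contDiffOn.mul hg).congr fun z hz => ?_
    rw [hform z hz]
    have h1 : D.coord (C.point (sqNorm z)) j = ‖z k₀‖ ^ 2 := by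
      have h2 : C.coord (C.point (sqNorm z)) k₀ = ‖z k₀‖ ^ 2 := congrFun (C.coord_point _) k₀
      rw [← h2, coord, coord, hk₀']
    have h3 : ∏ k ∈ Finset.univ.filter (· ∉ K), (phase (z k) : ℂ) ^ N j k = phase (z k₀) := by
      rw [Finset.prod_eq_single k₀]
      · rw [hN k₀ hk₀K, if_pos hk₀', zpow_one]
      · intro k hk hne
        rw [hN k (Finset.mem_filter.1 hk).2, if_neg, zpow_zero]
        rw [← hk₀', ← Subtype.ext_iff, C.facet.apply_eq_iff_eq]
        exact hne
      · intro hcon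
        exact absurd (Finset.mem_filter.2 ⟨Finset.mem_univ k₀, hk₀K⟩) hcon
    rw [h1, h3, Real.sqrt_sq (norm_nonneg _), ← mul_assoc, norm_mul_phase]
  · -- the facet does not pass through the first corner
    -- The slack of this facet is positive on `S`, where the square root is smooth.
    have hpos : ∀ z ∈ S, D.coord (C.point (sqNorm z)) j ≠ 0 := fun z hz =>
      (sub_pos.2 (hz.1 _ hj)).ne'
    have hsqrt : ContDiffOn ℝ ∞ (fun z => ((√(D.coord (C.point (sqNorm z)) j) : ℝ) : ℂ)) S :=
      Complex.ofRealCLM.contDiff.comp_contDiffOn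
        ((C.contDiff_coord_point D j).contDiffOn.sqrt hpos)
    refine (hsqrt.mul hg).congr fun z hz => ?_
    rw [hform z hz]
    have h3 : ∏ k ∈ Finset.univ.filter (· ∉ K), (phase (z k) : ℂ) ^ N j k = 1 := by
      refine Finset.prod_eq_one fun k hk => ?_
      rw [hN k (Finset.mem_filter.1 hk).2, if_neg, zpow_zero]
      intro hcon
      exact hj (hcon ▸ (C.facet k).2)
    rw [h3, one_mul]

end Corner

/-! ### Pairs without singular vertices -/

theorem IsPresentation.exists_corner_nbhd (h : A.IsPresentation a b)
    (hreg : ∀ v ∈ vertices A.poly, A.singOrder {v} = 1) {x : Fin n → ℝ} (hx : x ∈ A.poly) :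
    ∃ C : Corner A a b, x ∈ C.nbhd := by
  obtain ⟨v, hv, hvx, -⟩ := h.exists_vertex_max
    (h.isFace_faceOf (J := tightSet a b x) ⟨x, hx, subset_rfl⟩) 0
  obtain ⟨C, rfl⟩ := h.exists_corner hv (hreg v hv)
  exact ⟨C, (C.mem_nbhd_iff h hx).2 hvx.2⟩

/-- The charts at the corners. -/
abbrev chartedSpace (h : A.IsPresentation a b)
    (hreg : ∀ v ∈ vertices A.poly, A.singOrder {v} = 1) : ChartedSpace (Fin n → ℂ) A.Space where
  atlas := Set.range fun C : Corner A a b => C.chart h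
  chartAt m := ((h.exists_corner_nbhd hreg (A.orbitMap m).2).choose).chart h
  mem_chart_source m := (h.exists_corner_nbhd hreg (A.orbitMap m).2).choose_spec
  chart_mem_atlas _ := ⟨_, rfl⟩

theorem isManifold (h : A.IsPresentation a b)
    (hreg : ∀ v ∈ vertices A.poly, A.singOrder {v} = 1) :
    letI := chartedSpace h hreg
    IsManifold 𝓘(ℝ, Fin n → ℂ) ∞ A.Space := by
  let _ := chartedSpace h hreg
  refine isManifold_of_contDiffOn _ _ _ ?_
  rintro _ _ ⟨C, rfl⟩ ⟨D, rfl⟩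
  refine (C.contDiffOn_transition D h).mono ?_
  rintro z ⟨hz, -⟩
  have hz : z ∈ C.chartTarget ∧ C.chartInv z ∈ D.chartSource := hz
  refine ⟨hz.1, ?_⟩
  have h2 := hz.2
  rw [C.chartInv_of_mem h hz.1] at h2
  exact h2

/-- Facets with a common point all pass through some vertex. The vectors there form a basis of `ℤⁿ`,
and those not in the family span a complement. -/
theorem IsPresentation.isCharacteristic (h : A.IsPresentation a b)
    (hreg : ∀ v ∈ vertices A.poly, A.singOrder {v} = 1) : A.IsCharacteristic := by
  intro S hS
  obtain ⟨v, hv, hSv⟩ : ∃ v ∈ vertices A.poly, S ⊆ tightSet a b v := by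
    rcases S.eq_empty_or_nonempty with rfl | ⟨F₀, hF₀⟩
    · obtain ⟨v, hv, -⟩ := h.exists_vertex_max ⟨IsExposed.refl _, h.nonempty⟩ 0
      exact ⟨v, hv, Set.empty_subset _⟩
    · obtain ⟨x, hx⟩ := hS
      have hx : ∀ F ∈ S, x ∈ F.1 := fun F hF => Set.mem_iInter₂.1 hx F hF
      have hxP := ((h.mem_facet F₀ x).1 (hx F₀ hF₀)).1
      obtain ⟨v, hv, hvx, -⟩ := h.exists_vertex_max
        (h.isFace_faceOf (J := tightSet a b x) ⟨x, hxP, subset_rfl⟩) 0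
      exact ⟨v, hv, fun F hF => hvx.2 ((h.mem_facet F x).1 (hx F hF)).2⟩
  obtain ⟨C, rfl⟩ := h.exists_corner hv (hreg v hv)
  have himage : A.lam '' S = (fun G : tightSet a b C.pt => A.lam G.1) '' (Subtype.val ⁻¹' S) := by
    rw [← Set.image_image (g := A.lam) (f := Subtype.val), Subtype.image_preimage_coe,
      Set.inter_eq_right.2 hSv]
  refine ⟨Submodule.span ℤ ((fun G : tightSet a b C.pt => A.lam G.1) '' (Subtype.val ⁻¹' S)ᶜ),
    ?_, ?_⟩
  · rw [himage]
    exact (h.linearIndepOn C.pt_mem).linearIndependent.disjoint_span_image disjoint_compl_right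
  · rw [himage, codisjoint_iff, ← Submodule.span_union, ← Set.image_union, Set.union_compl_self,
      Set.image_univ, eq_top_iff]
    rintro x -
    have hx : x = ∑ j, (C.mat.mulVec x) j • A.lam (C.facet j).1 := by
      have h1 : x = C.colMat.mulVec (C.mat.mulVec x) := by
        rw [Matrix.mulVec_mulVec, C.colMat_mul_mat, Matrix.one_mulVec]
      conv_lhs => rw [h1]
      funext i
      simp [Matrix.mulVec, dotProduct, Corner.colMat, mul_comm]
    rw [hx]
    exact Submodule.sum_mem _ fun j _ => Submodule.smul_mem _ _
      (Submodule.subset_span ⟨C.facet j, rfl⟩)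

/-- If the local groups at all vertices are trivial, then the space is a toric manifold. -/
theorem IsPresentation.isToricManifold (h : A.IsPresentation a b)
    (hreg : ∀ v ∈ vertices A.poly, A.singOrder {v} = 1) : A.IsToricManifold := by
  have hcomp : CompactSpace A.poly := isCompact_iff_compactSpace.1 h.isCompact
  have hcompact : CompactSpace A.Space := ⟨by
    rw [← A.proj_surjective.range_eq]
    exact isCompact_range A.isQuotientMap_proj.continuous⟩
  refine ⟨h.isCharacteristic hreg, hcompact, ⟨fun m m' hne => ?_⟩, ?_,
    ⟨chartedSpace h hreg, isManifold h hreg, ?_⟩,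
    A.continuous_orbitMap.isClosedMap.isQuotientMap A.continuous_orbitMap A.orbitMap_surjective,
    orbitMap_eq_orbitMap_iff⟩
  -- Points of one orbit lie in a common invariant chart and are separated there; points of
  -- different orbits are separated in `P`.
  · by_cases ho : A.orbitMap m = A.orbitMap m'
    · obtain ⟨C, hC⟩ := h.exists_corner_nbhd hreg (A.orbitMap m).2
      have hm : m ∈ (C.chart h).source := hC
      have hm' : m' ∈ (C.chart h).source := by
        change (A.orbitMap m').1 ∈ C.nbhd
        rw [← ho]
        exact hC
      have hne' : C.chart h m ≠ C.chart h m' := fun he => hne ((C.chart h).injOn hm hm' he)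
      obtain ⟨u, u', hu, hu', hmu, hmu', hd⟩ := t2_separation hne'
      exact ⟨_, _, (C.chart h).isOpen_inter_preimage hu, (C.chart h).isOpen_inter_preimage hu',
        ⟨hm, hmu⟩, ⟨hm', hmu'⟩, (hd.preimage _).mono Set.inter_subset_right
          Set.inter_subset_right⟩
    · obtain ⟨u, u', hu, hu', hmu, hmu', hd⟩ := t2_separation ho
      exact ⟨_, _, hu.preimage A.continuous_orbitMap, hu'.preimage A.continuous_orbitMap, hmu,
        hmu', hd.preimage _⟩
  · let _ := chartedSpace h hreg
    exact ChartedSpace.secondCountable_of_sigmaCompact (Fin n → ℂ) A.Space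
  · rintro _ ⟨C, rfl⟩
    exact ⟨fun t m hm => C.smul_mem_chartSource hm t,
      torusEquiv C.mat C.colMat C.mat_mul_colMat C.colMat_mul_mat,
      fun t m hm => C.chartFun_smul h hm t⟩

/-- Strong induction on `complexity`. A singular vertex is itself a singular face, so a maximal one
exists and can be blown up. -/
theorem exists_resolution (hn : 1 ≤ n) (N : ℕ) (A : RCharPair n) (hA : A.complexity = N) :
    ∃ (d : ℕ) (X : ℕ → RCharPair n), X 0 = A ∧
      (∀ i < d, (X i).IsResolutionStep (X (i + 1))) ∧ (X d).IsToricManifold := by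
  induction N using Nat.strong_induction_on generalizing A with
  | _ N ih =>
    by_cases hreg : ∀ v ∈ vertices A.poly, A.singOrder {v} = 1
    · obtain ⟨a, b, h⟩ := A.exists_isPresentation hn
      exact ⟨0, fun _ => A, rfl, fun i hi => absurd hi (Nat.not_lt_zero i),
        h.isToricManifold hreg⟩
    · push Not at hreg
      obtain ⟨v, hv, hs⟩ := hreg
      obtain ⟨F, hF⟩ := A.exists_isMaximalSingular hn hv hs
      obtain ⟨B, hB⟩ := A.exists_isResolutionStep hn hF
      obtain ⟨d, X, hX0, hX, hXd⟩ := ih _ (hA ▸ hB.complexity_lt hn) B rfl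
      refine ⟨d + 1, fun i => Nat.casesOn i A X, rfl, ?_, hXd⟩
      rintro (_ | i) hi
      · change A.IsResolutionStep (X 0)
        rw [hX0]
        exact hB
      · exact hX i (Nat.lt_of_succ_lt_succ hi)

end RCharPair

end

end ToricOrb

end

theorem theorem2p6 (n : ℕ) (hn : 1 ≤ n) (A : ToricOrb.RCharPair n) :
    ∃ (d : ℕ) (X : ℕ → ToricOrb.RCharPair n), X 0 = A ∧
      (∀ i < d, (X i).IsResolutionStep (X (i + 1))) ∧
      (X d).IsToricManifold :=
  A.exists_resolution hn _ rfl
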